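/- Let $\mathbb F_q$ be a finite field and let $A,B$ be univariate polynomials over $\mathbb F_q$ such that $A(Y)-B(X)$ is absolutely irreducible. Let $\mathcal X$ be the nonsingular projective curve over $\mathbb F_q$ whose function field $K$ is the field of fractions of $\mathbb F_q[X,Y]/(A(Y)-B(X))$, and let $x,y\in K$ be the classes of $X,Y$. Assume condition $(*)$: there is a rational point $Q\in\mathcal X(\mathbb F_q)$ that is the only pole of $x$ and the only pole of $y$. Divisors on $\mathcal X$ are taken over $\mathbb F_q$; for a divisor $E$ put $\mathcal L(E)=\{f\in K^*:\operatorname{div}(f)+E\ge 0\}\cup\{0\}$, $\ell(E)=\dim_{\mathbb F_q}\mathcal L(E)$, and for $t\ge 1$ let $\gamma_t=\min\{\deg E:\ell(E)\ge t\}$ be the $t$-th gonality of $\mathcal X$. Let $v$ denote the pole order at $Q$ (with the convention $v(0)=0$). Let $\phi_1,\phi_2\in\bigcup_{j\ge 0}\mathcal L(jQ)$, and let $\mathcal P_1,\dots,\mathcal P_s$ be pairwise disjoint sets of rational points of $\mathcal X$ different from $Q$, such that $\phi_1$ is constant on each $\mathcal P_i$. Fix an integer $r\ge 1$, let $\mathcal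 P$ be the union of those $\mathcal P_i$ on which $\phi_2$ takes at least $r+1$ different values, and put $n=\#\mathcal P$ and $D=\sum_{P\in\mathcal P}P$. For $\epsilon_0,\dots,\epsilon_{r-1}\in\{0,1\}$ and integers $\ell_0,\dots,\ell_{r-1}\ge 0$ let $$V=\sum_{i=0}^{r-1}\epsilon_i\langle 1,\phi_1,\dots,\phi_1^{\ell_i}\rangle\phi_2^i,\qquad m=\max_{0\le i\le r-1}\epsilon_i\bigl(\ell_i v(\phi_1)+i\,v(\phi_2)\bigr),$$ and write $\ell(V)=\dim_{\mathbb F_q}V$, $\mathcal L_V(mQ-D)=V\cap\mathcal L(mQ-D)$ and $w=\ell(mQ-D)$. For a space $W$ of functions without poles in $\mathcal P$ let $\mathcal C(\mathcal P,W)=\{(f(P))_{P\in\mathcal P}:f\in W\}\subseteq\mathbb F_q^{n}$. A linear code is called locally recoverable (LRC) of locality $r$ if for every coordinate $i$ there is a set $R$ of at most $r$ coordinates with $i\notin R$ such that any two codewords that agree on $R$ agree at $i$. Then $\mathcal C(\mathcal P,V)$ is a linear LRC code of length $n$ and locality $r$, its dimension $k$ satisfies $$k=\ell(V)-\dim\mathcal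 L_V(mQ-D)\ \ge\ \ell(V)-w,$$ and, if $\mathcal C(\mathcal P,V)\ne 0$, its minimum distance $d$ satisfies $$d\ \ge\ d(\mathcal C(\mathcal P,\mathcal L(mQ)))\ \ge\ n-m+\gamma_{w+1}.$$ The second inequality holds whenever $\mathcal C(\mathcal P,\mathcal L(mQ))\neq 0$. In particular, if $m<n$, then $w=0$, $k=\ell(V)$ and (if $\mathcal C(\mathcal P,V)\ne 0$) $d\ge n-m$. -/

import Mathlib

open scoped Polynomial WithZero

namespace SepCurve

/-! ### Places and divisors of a function field -/

/-- A place of `K / F` (a closed point of the nonsingular projective curve with function field `K`):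
a normalized (surjective) discrete valuation of `K` that is trivial on `F`. In the multiplicative
notation of Mathlib, `v f = exp (-ord f)`. -/
@[ext]
structure Place (F K : Type*) [Field F] [Field K] [Algebra F K] where
  /-- the normalized discrete valuation -/
  v : Valuation K ℤᵐ⁰
  surjective : Function.Surjective v
  trivial_on : ∀ c : F, c ≠ 0 → v (algebraMap F K c) = 1

namespace Place

variable {F K : Type*} [Field F] [Field K] [Algebra F K]

theorem v_algebraMap_le (P : Place F K) (c : F) : P.v (algebraMap F K c) ≤ 1 := by
  by_cases hc : c = 0
  · simp [hc]
  · exact (P.trivial_on c hc).le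

theorem v_smul_le (P : Place F K) (c : F) (f : K) : P.v (c • f) ≤ P.v f := by
  rw [Algebra.smul_def, map_mul]
  exact mul_le_of_le_one_left' (P.v_algebraMap_le c)

/-- The valuation ring of the place: the functions without a pole at `P`. -/
def ring (P : Place F K) : Subalgebra F K where
  carrier := {f | P.v f ≤ 1}
  mul_mem' {f g} hf hg := by
    simp only [Set.mem_ofPred_eq, map_mul] at *
    exact mul_le_one' hf hg
  add_mem' {f g} hf hg := P.v.map_add_le hf hg
  algebraMap_mem' c := P.v_algebraMap_le c

/-- The maximal ideal of the valuation ring: the functions vanishing at `P`. -/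
def maxIdeal (P : Place F K) : Ideal P.ring where
  carrier := {f | P.v (f : K) < 1}
  add_mem' {f g} hf hg := by
    simpa using P.v.map_add_lt hf hg
  zero_mem' := by simp
  smul_mem' c f hf := by
    have hc : P.v (c : K) ≤ 1 := c.2
    simp only [Set.mem_ofPred_eq, smul_eq_mul, MulMemClass.coe_mul, map_mul] at *
    exact lt_of_le_of_lt (mul_le_of_le_one_left' hc) hf

/-- The degree of a place: the dimension over `F` of its residue field. -/
noncomputable def degree (P : Place F K) : ℕ := Module.finrank F (P.ring ⧸ P.maxIdeal)

/-- Rational points are the places of degree one. -/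
def IsRational (P : Place F K) : Prop := P.degree = 1

/-- `P` is a pole of `f`. -/
def IsPole (P : Place F K) (f : K) : Prop := 1 < P.v f

/-- The pole order of `f` at `P`, for a function `f` with `ord_P f ≤ 0` (and `0` when `f = 0` or
`ord_P f > 0`). -/
noncomputable def poleOrder (P : Place F K) (f : K) : ℕ := (WithZero.log (P.v f)).toNat

/-- `f(P) = c`, that is, `f - c` vanishes at `P`. -/
def HasValue (P : Place F K) (f : K) (c : F) : Prop := P.v (f - algebraMap F K c) < 1

theorem HasValue.unique {P : Place F K} {f : K} {c d : F} (hc : P.HasValue f c)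
    (hd : P.HasValue f d) : c = d := by
  by_contra h
  have h1 : P.v (algebraMap F K (d - c)) = 1 := P.trivial_on _ (sub_ne_zero.2 (Ne.symm h))
  have h2 : algebraMap F K (d - c) =
      (f - algebraMap F K c) - (f - algebraMap F K d) := by rw [map_sub]; ring
  have h3 : P.v ((f - algebraMap F K c) - (f - algebraMap F K d)) < 1 :=
    lt_of_le_of_lt (P.v.map_sub _ _) (max_lt hc hd)
  rw [← h2, h1] at h3
  exact lt_irrefl _ h3

end Place

/-- Divisors of `K / F`, defined over `F`: finite formal integral combinations of places. -/
abbrev Divisor (F K : Type*) [Field F] [Field K] [Algebra F K] := Place F K →₀ ℤ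

section Divisors

variable {F K : Type*} [Field F] [Field K] [Algebra F K]

/-- The degree of a divisor. -/
noncomputable def Divisor.deg (E : Divisor F K) : ℤ := E.sum fun P n => n * (P.degree : ℤ)

/-- The Riemann space `L(E) = {f | div f + E ≥ 0} ∪ {0}`; the condition `ord_P f + E P ≥ 0` reads
`v_P f ≤ exp (E P)` and holds for `f = 0`. -/
def riemannSpace (E : Divisor F K) : Submodule F K where
  carrier := {f | ∀ P : Place F K, P.v f ≤ WithZero.exp (E P)}
  add_mem' hf hg P := P.v.map_add_le (hf P) (hg P)
  zero_mem' P := by simp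
  smul_mem' c f hf P := (P.v_smul_le c f).trans (hf P)

/-- `ℓ(E) = dim L(E)`. -/
noncomputable def ell (E : Divisor F K) : ℕ := Module.finrank F (riemannSpace E)

/-- `L(∞Q)`, the union of the spaces `L(mQ)` over `m ≥ 0`. -/
noncomputable def riemannSpaceInfty (Q : Place F K) : Set K :=
  ⋃ m : ℕ, (riemannSpace (Finsupp.single Q (m : ℤ)) : Set K)

variable (F K) in
/-- The `t`-th gonality: the least degree of a divisor `E` (over `F`) with `ℓ(E) ≥ t`. -/
noncomputable def gonality (t : ℕ) : ℤ :=
  sInf {δ : ℤ | ∃ E : Divisor F K, t ≤ ell E ∧ E.deg = δ}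

end Divisors

/-! ### Linear codes -/

section Codes

variable {F : Type*} [Field F] {ι : Type*} [Fintype ι]

/-- The minimum distance of a nonzero linear code (`0` for the zero code). -/
noncomputable def minDist (C : Submodule F (ι → F)) : ℕ :=
  open Classical in sInf {d | ∃ u ∈ C, ∃ v ∈ C, u ≠ v ∧ hammingDist u v = d}

/-- The coordinate `i` is locally recoverable with locality `r`: there is a recovery set `R` of
cardinality `r`, not containing `i`, such that codewords agreeing on `R` agree at `i`. -/
def IsLocallyRecoverableAt (C : Submodule F (ι → F)) (i : ι) (r : ℕ) : Prop :=
  ∃ R : Finset ι, i ∉ R ∧ R.card = r ∧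
    ∀ u ∈ C, ∀ v ∈ C, (∀ j ∈ R, u j = v j) → u i = v i

/-- A locally recoverable code of locality `r`: every coordinate is locally recoverable with
locality at most `r`. -/
def IsLRC (C : Submodule F (ι → F)) (r : ℕ) : Prop :=
  ∀ i, ∃ r' ≤ r, IsLocallyRecoverableAt C i r'

end Codes

section EvaluationCodes

variable {F K : Type*} [Field F] [Field K] [Algebra F K]

/-- The evaluation code `ev_pts(W)` at the points of `pts`: the words `(f(P))_{P ∈ pts}` with `f ∈ W`. -/
def evalCode (pts : Finset (Place F K)) (W : Submodule F K) : Submodule F (pts → F) where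
  carrier := {c | ∃ f ∈ W, ∀ P : pts, P.1.HasValue f (c P)}
  add_mem' := by
    rintro c d ⟨f, hf, hfc⟩ ⟨g, hg, hgd⟩
    refine ⟨f + g, W.add_mem hf hg, fun P => ?_⟩
    have := P.1.v.map_add_lt (hfc P) (hgd P)
    rwa [show f - algebraMap F K (c P) + (g - algebraMap F K (d P)) =
      f + g - algebraMap F K ((c + d) P) by simp only [Pi.add_apply, map_add]; ring] at this
  zero_mem' := ⟨0, W.zero_mem, fun P => by simp [Place.HasValue]⟩
  smul_mem' := by
    rintro a c ⟨f, hf, hfc⟩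
    refine ⟨a • f, W.smul_mem a hf, fun P => ?_⟩
    have := lt_of_le_of_lt (P.1.v_smul_le a _) (hfc P)
    rwa [show a • (f - algebraMap F K (c P)) = a • f - algebraMap F K ((a • c) P) by
      simp only [Pi.smul_apply, smul_eq_mul, map_mul, Algebra.smul_def]; ring] at this

/-- The number of different values that `f` takes on the finite set of points `S`. -/
noncomputable def numValues (f : K) (S : Finset (Place F K)) : ℕ :=
  {c : F | ∃ P ∈ S, P.HasValue f c}.ncard

/-- `f` is constant on `S`. -/
def IsConstantOn (f : K) (S : Finset (Place F K)) : Prop :=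
  ∃ c : F, ∀ P ∈ S, P.HasValue f c

variable (F) in
/-- `V = ∑_{i<r} ε_i ⟨1, φ₁, …, φ₁^{ℓ_i}⟩ φ₂^i`, where `ε_i ∈ {0, 1}`. -/
noncomputable def evalSpace (φ₁ φ₂ : K) {r : ℕ} (ε : Fin r → Fin 2) (l : Fin r → ℕ) :
    Submodule F K :=
  ⨆ i : Fin r, Submodule.span F
    {f | ∃ j ≤ l i, f = ((ε i : ℕ) : K) * (φ₁ ^ j * φ₂ ^ (i : ℕ))}

/-- `m(V) = max {ε_i (ℓ_i v(φ₁) + i v(φ₂)) : i < r}`, where `v` is the pole order at `Q`. -/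
noncomputable def evalSpaceBound (Q : Place F K) (φ₁ φ₂ : K) {r : ℕ}
    (ε : Fin r → Fin 2) (l : Fin r → ℕ) : ℕ :=
  Finset.univ.sup fun i : Fin r =>
    (ε i : ℕ) * (l i * Q.poleOrder φ₁ + (i : ℕ) * Q.poleOrder φ₂)

end EvaluationCodes

/-! ### Curves with separated variables -/

section Curves

variable {F : Type*} [Field F]

/-- `A(Y) - B(X)` as a polynomial in `Y` over `F[X]`. -/
noncomputable def sepPoly (A B : F[X]) : F[X][X] := A.map Polynomial.C - Polynomial.C B

/-- `A(Y) - B(X)` is absolutely irreducible. -/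
def AbsolutelyIrreducible (A B : F[X]) : Prop :=
  Irreducible (sepPoly (A.map (algebraMap F (AlgebraicClosure F)))
    (B.map (algebraMap F (AlgebraicClosure F))))

/-- The coordinate ring `F[X, Y] / (A(Y) - B(X))`. -/
abbrev CoordRing (A B : F[X]) : Type _ := AdjoinRoot (sepPoly A B)

variable (K : Type*) [Field K]

/-- The coordinate function `x`. -/
noncomputable def xFun (A B : F[X]) [Algebra (CoordRing A B) K] : K :=
  algebraMap (CoordRing A B) K (AdjoinRoot.of (sepPoly A B) Polynomial.X)

/-- The coordinate function `y`. -/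
noncomputable def yFun (A B : F[X]) [Algebra (CoordRing A B) K] : K :=
  algebraMap (CoordRing A B) K (AdjoinRoot.root (sepPoly A B))

variable [Algebra F K]

/-- Condition (*): `Q` is a rational point, and it is the only pole of `x` and the only
pole of `y`. -/
def ConditionStar (A B : F[X]) [Algebra (CoordRing A B) K] (Q : Place F K) : Prop :=
  Q.IsRational ∧ (∀ P : Place F K, P.IsPole (xFun K A B) ↔ P = Q) ∧
    ∀ P : Place F K, P.IsPole (yFun K A B) ↔ P = Q

end Curves

end SepCurve

open SepCurve

namespace SepCurve

open IsDedekindDomain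

/-! ### Places as primes of Dedekind domains; functions without poles -/

section DedekindModels

variable {F K : Type*} [Field F] [Field K] [Algebra F K]

/-! The coding statements need little. On a set where `φ₁` is constant, a function of `V` is a
polynomial of degree less than `r` in `φ₂`, so its value at a point can be interpolated from points
with `r` other values of `φ₂` (`isLocallyRecoverableAt_evalCode`). The kernel of evaluation on `V`
is `V ∩ L(mQ - D)` (`finrank_evalCode_add`). If two different words agree exactly on `T`, the
difference of their functions lies in `L(mQ - ∑ T)` but not in the subspace `L(mQ - D)`. Hence `ℓ(mQ
- ∑ T) ≥ w + 1`, and `m - #T` is at least the gonality (`minDist_evalCode_ge`).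

Two facts about curves are used: `L(E)` is finite dimensional, and `L(E) ≠ 0` forces `deg E ≥ 0`.
The second bounds the degrees in the definition of the gonality from below, and gives `w = 0` for `m
< n`.

Both are proved from valuations. By absolute irreducibility the derivatives of `A` and `B` do not
both vanish, so `x` or `y` is a separating element `t` whose only pole is `Q`. The integral closure
of `F[t]` in `K` is a Dedekind domain; it consists of the functions regular outside `Q`, and its
primes give all places other than `Q`. A function without poles is integral over `F[t]` and
`F[1/t]`, hence algebraic over `F`, hence has no zeros. Strong approximation then gives `ℓ(E + jQ) =
j + deg E + g` for large `j`, with `g` independent of `E`. A nonzero `f ∈ L(E)` embeds `L(jQ)` into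
`L(E + jQ)` by multiplication, so `deg E ≥ 0`; the degree of a principal divisor is never computed.
-/

theorem lt_one_iff_le_exp_neg_one {x : ℤᵐ⁰} : x < 1 ↔ x ≤ WithZero.exp (-1) := by
  induction x using WithZero.expRecOn with
  | zero => simp
  | exp n =>
    rw [← WithZero.exp_zero, WithZero.exp_lt_exp, WithZero.exp_le_exp]
    omega

/-- Equivalent normalized discrete valuations are equal. -/
theorem valuation_eq_of_isEquiv {v w : Valuation K ℤᵐ⁰} (hv : Function.Surjective v)
    (hw : Function.Surjective w) (h : v.IsEquiv w) : v = w := by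
  obtain ⟨π, hπ⟩ := hv (WithZero.exp (-1))
  obtain ⟨ϖ, hϖ⟩ := hw (WithZero.exp (-1))
  have h1 : w π < 1 := by
    rw [← h.lt_one_iff_lt_one, lt_one_iff_le_exp_neg_one, hπ]
  have h2 : v ϖ < 1 := by
    rw [h.lt_one_iff_lt_one, lt_one_iff_le_exp_neg_one, hϖ]
  have h3 : w ϖ ≤ w π := by
    rw [← h.le_iff_le, hπ]
    exact lt_one_iff_le_exp_neg_one.1 h2
  -- A uniformizer of `v` is thus one of `w`, and comparison with its powers determines both
  -- valuations.
  have h4 : w π = WithZero.exp (-1) :=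
    le_antisymm (lt_one_iff_le_exp_neg_one.1 h1) (hϖ ▸ h3)
  ext f
  by_cases hf : f = 0
  · simp [hf]
  obtain ⟨n, hn⟩ : ∃ n : ℤ, v f = WithZero.exp n :=
    ⟨_, (WithZero.exp_log (by simpa using hf)).symm⟩
  have h5 : v f = v (π ^ (-n)) := by
    rw [hn, map_zpow₀, hπ, ← WithZero.exp_zsmul]
    simp
  rw [h5, h.eq_iff.1 h5, map_zpow₀, map_zpow₀, hπ, h4]

theorem Place.exists_eq_exp (P : Place F K) {f : K} (hf : f ≠ 0) :
    ∃ n : ℤ, P.v f = WithZero.exp n :=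
  ⟨_, (WithZero.exp_log (by simpa using hf)).symm⟩

section Models

variable {R : Type*} [CommRing R] [IsDedekindDomain R] [Algebra R K] [IsFractionRing R K]

/-- The place attached to a nonzero prime of a Dedekind domain with fraction field `K`. -/
noncomputable def placeOfPrime [Algebra F R] [IsScalarTower F R K] (p : HeightOneSpectrum R) :
    Place F K where
  v := p.valuation K
  surjective := p.valuation_surjective K
  trivial_on c hc := by
    rw [IsScalarTower.algebraMap_apply F R K, p.valuation_eq_one_iff_notMem]
    intro h
    exact p.isPrime.ne_top (Ideal.eq_top_of_isUnit_mem _ h ((IsUnit.mk0 c hc).map _))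

/-- A place that is nonnegative on a Dedekind domain with fraction field `K` comes from a prime. -/
theorem Place.exists_valuation_eq (P : Place F K)
    (hR : ∀ r : R, P.v (algebraMap R K r) ≤ 1) :
    ∃ p : HeightOneSpectrum R, P.v = p.valuation K := by
  let I : Ideal R :=
    { carrier := {r | P.v (algebraMap R K r) < 1}
      add_mem' := fun {a b} ha hb => by
        simpa using P.v.map_add_lt ha hb
      zero_mem' := by simp
      smul_mem' := fun c f hf => by
        simp only [Set.mem_ofPred_eq, smul_eq_mul, map_mul] at *
        exact lt_of_le_of_lt (mul_le_of_le_one_left' (hR c)) hf }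
  have hI : ∀ r, r ∈ I ↔ P.v (algebraMap R K r) < 1 := fun r => Iff.rfl
  have hnot : ∀ r, r ∉ I → P.v (algebraMap R K r) = 1 := fun r hr =>
    le_antisymm (hR r) (not_lt.1 hr)
  have hprime : I.IsPrime := by
    refine ⟨fun h => ?_, fun {a b} hab => ?_⟩
    · have : (1 : R) ∈ I := h ▸ Submodule.mem_top
      rw [hI] at this
      simp at this
    · by_contra! h
      rw [hI, map_mul, map_mul, hnot a h.1, hnot b h.2] at hab
      simp at hab
  -- If the centre of `P` were zero, all denominators would be units at `P` and no function would
  -- have a pole there.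
  have hne : I ≠ ⊥ := by
    intro h
    obtain ⟨f, hf⟩ := P.surjective (WithZero.exp 1)
    obtain ⟨a, b, hb, rfl⟩ := IsFractionRing.div_surjective (A := R) f
    have hb0 : b ∉ I := by
      rw [h]
      simpa using nonZeroDivisors.ne_zero hb
    rw [map_div₀, hnot b hb0, div_one] at hf
    have := hR a
    rw [hf, ← WithZero.exp_zero, WithZero.exp_le_exp] at this
    omega
  let p : HeightOneSpectrum R := ⟨I, hprime, hne⟩
  refine ⟨p, valuation_eq_of_isEquiv P.surjective (p.valuation_surjective K) ?_⟩
  -- The localization at `p` is a discrete valuation ring, so no ring lies strictly between it and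
  -- `K`.
  have hle : (p.valuation K).valuationSubring ≤ P.v.valuationSubring := by
    intro f hf
    obtain ⟨n, d, hnd⟩ := p.exists_primeCompl_mul_eq_of_integer f hf
    have hd := hnot d d.2
    have := hR n
    rwa [← hnd, map_mul, hd, mul_one] at this
  have htop : P.v.valuationSubring ≠ ⊤ := by
    intro h
    obtain ⟨f, hf⟩ := P.surjective (WithZero.exp 1)
    have : f ∈ P.v.valuationSubring := h ▸ trivial
    rw [Valuation.mem_valuationSubring_iff, hf, ← WithZero.exp_zero, WithZero.exp_le_exp] at this
    omega
  rw [← HeightOneSpectrum.valuationSubringAtPrime_eq_valuationSubring] at hle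
  have := ValuationSubring.eq_of_le_of_ne_top _ hle htop
  rw [HeightOneSpectrum.valuationSubringAtPrime_eq_valuationSubring] at this
  exact (Valuation.isEquiv_iff_valuationSubring _ _).2 this.symm

end Models

section Adjoin

open IntermediateField IntermediateField.algebraAdjoinAdjoin

instance (t : K) : IsPrincipalIdealRing (Algebra.adjoin F {t}) := by
  rw [Algebra.adjoin_singleton_eq_range_aeval]
  exact IsPrincipalIdealRing.of_surjective (Polynomial.aeval (R := F) t).rangeRestrict
    (Polynomial.aeval (R := F) t).rangeRestrict_surjective

theorem isDedekindDomain_integralClosure_adjoin (t : K) [FiniteDimensional F⟮t⟯ K]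
    [Algebra.IsSeparable F⟮t⟯ K] :
    IsDedekindDomain (integralClosure (Algebra.adjoin F {t}) K) :=
  integralClosure.isDedekindDomain (Algebra.adjoin F {t}) F⟮t⟯ K

theorem isFractionRing_integralClosure_adjoin (t : K) [FiniteDimensional F⟮t⟯ K] :
    IsFractionRing (integralClosure (Algebra.adjoin F {t}) K) K :=
  integralClosure.isFractionRing_of_finite_extension F⟮t⟯ K

theorem Place.le_one_of_mem_adjoin (P : Place F K) {t : K} (ht : P.v t ≤ 1) {f : K}
    (hf : f ∈ Algebra.adjoin F {t}) : P.v f ≤ 1 :=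
  Algebra.adjoin_le (S := P.ring) (Set.singleton_subset_iff.2 ht) hf

theorem Place.le_one_of_isIntegral (P : Place F K) {t : K} (ht : P.v t ≤ 1) {f : K}
    (hf : IsIntegral (Algebra.adjoin F {t}) f) : P.v f ≤ 1 := by
  have h1 : Algebra.adjoin F {t} ≤ P.ring := fun f hf => P.le_one_of_mem_adjoin ht hf
  have h2 : IsIntegral P.v.valuationSubring f := by
    obtain ⟨g, hg, hgf⟩ := hf
    refine ⟨g.map (Subalgebra.inclusion h1).toRingHom, hg.map _, ?_⟩
    rw [← hgf]
    exact Polynomial.eval₂_map _ _ _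
  exact (Valuation.Integers.isIntegral_iff_v_le_one (v := P.v)
    (Valuation.integer.integers P.v)).1 h2

/-- The functions regular at all places where `t` is regular are integral over `F[t]`. -/
theorem isIntegral_adjoin_iff (t : K) [FiniteDimensional F⟮t⟯ K]
    [Algebra.IsSeparable F⟮t⟯ K] (f : K) :
    IsIntegral (Algebra.adjoin F {t}) f ↔ ∀ P : Place F K, P.v t ≤ 1 → P.v f ≤ 1 := by
  refine ⟨fun h P ht => P.le_one_of_isIntegral ht h, fun h => ?_⟩
  have := isDedekindDomain_integralClosure_adjoin (F := F) t
  have := isFractionRing_integralClosure_adjoin (F := F) t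
  have hC : ∀ p : HeightOneSpectrum (integralClosure (Algebra.adjoin F {t}) K),
      p.valuation K f ≤ 1 := fun p => h (placeOfPrime p) <| p.valuation_le_one (K := K)
    ⟨t, isIntegral_algebraMap
      (x := (⟨t, Algebra.self_mem_adjoin_singleton F t⟩ : Algebra.adjoin F {t}))⟩
  obtain ⟨g, rfl⟩ := HeightOneSpectrum.mem_integers_of_valuation_le_one K f hC
  exact g.2

/-- At a pole of `t` the leading term strictly dominates all others. -/
theorem Place.v_aeval (Q : Place F K) {t : K} (ht : 1 < Q.v t) {p : F[X]} (hp : p ≠ 0) :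
    Q.v (Polynomial.aeval t p) = Q.v t ^ p.natDegree := by
  have hlead : Q.v (p.leadingCoeff • t ^ p.natDegree) = Q.v t ^ p.natDegree := by
    rw [Algebra.smul_def, map_mul, Q.trivial_on _ (Polynomial.leadingCoeff_ne_zero.2 hp), one_mul,
      map_pow]
  rw [Polynomial.aeval_eq_sum_range, Finset.sum_range_succ, Polynomial.coeff_natDegree,
    Q.v.map_add_eq_of_lt_right, hlead]
  rw [hlead]
  refine Q.v.map_sum_lt (pow_ne_zero _ (zero_lt_one.trans ht).ne') fun i hi => ?_
  refine (Q.v_smul_le _ _).trans_lt ?_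
  rw [map_pow]
  exact pow_lt_pow_right₀ ht (Finset.mem_range.1 hi)

theorem adjoin_simple_inv (t : K) : F⟮t⁻¹⟯ = F⟮t⟯ := by
  refine le_antisymm (adjoin_simple_le_iff.2 (inv_mem (mem_adjoin_simple_self F t)))
    (adjoin_simple_le_iff.2 ?_)
  simpa using inv_mem (mem_adjoin_simple_self F t⁻¹)

/-- A function integral over `F[t]` and over `F[1/t]` is algebraic over `F`. -/
theorem isIntegral_of_isIntegral_adjoin_inv (Q : Place F K) {t : K} (ht : 1 < Q.v t) {f : K}
    (h1 : IsIntegral (Algebra.adjoin F {t}) f) (h2 : IsIntegral (Algebra.adjoin F {t⁻¹}) f) :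
    IsIntegral F f := by
  have hk := adjoin_simple_inv (F := F) t
  have e1 := minpoly.isIntegrallyClosed_eq_field_fractions' F⟮t⟯ h1
  have e2 := minpoly.isIntegrallyClosed_eq_field_fractions' F⟮t⁻¹⟯ h2
  have e3 : (minpoly F⟮t⁻¹⟯ f).map (algebraMap _ K) = (minpoly F⟮t⟯ f).map (algebraMap _ K) := by
    rw [hk]
  rw [e1, e2, Polynomial.map_map, Polynomial.map_map, ← IsScalarTower.algebraMap_eq,
    ← IsScalarTower.algebraMap_eq] at e3
  set g := (minpoly (Algebra.adjoin F {t}) f).map (algebraMap _ K) with hg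
  -- The coefficients of the minimal polynomial lie in `F[t]` and in `F[1/t]`: polynomials in `t`
  -- without a pole at `Q`, hence constants.
  have hlift : g ∈ Polynomial.lifts (algebraMap F K) := by
    rw [Polynomial.lifts_iff_coeff_lifts]
    intro i
    have hi1 : g.coeff i ∈ Algebra.adjoin F {t} := by
      rw [hg, Polynomial.coeff_map]
      exact Subtype.property _
    have hi2 : Q.v (g.coeff i) ≤ 1 := by
      refine Q.le_one_of_mem_adjoin (t := t⁻¹) ?_ ?_
      · rw [map_inv₀]
        exact inv_le_one_of_one_le₀ ht.le
      · rw [← e3, Polynomial.coeff_map]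
        exact Subtype.property _
    rw [Algebra.adjoin_singleton_eq_range_aeval] at hi1
    obtain ⟨p, hp⟩ := hi1
    change Polynomial.aeval t p = _ at hp
    rw [← hp] at hi2 ⊢
    by_cases hp0 : p = 0
    · exact ⟨0, by simp [hp0]⟩
    · rw [Q.v_aeval ht hp0] at hi2
      have hdeg : p.natDegree = 0 := by
        by_contra hne
        exact hi2.not_gt (one_lt_pow₀ ht hne)
      rw [Polynomial.eq_C_of_natDegree_eq_zero hdeg]
      exact ⟨p.coeff 0, by simp⟩
  obtain ⟨p, hp, -, hmonic⟩ := Polynomial.lifts_and_natDegree_eq_and_monic hlift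
    ((minpoly.monic h1).map _)
  refine ⟨p, hmonic, ?_⟩
  rw [← Polynomial.eval_map, hp, hg, Polynomial.eval_map]
  exact minpoly.aeval _ f

/-- Both `f` and `1/f` are integral over `F`, so neither has a pole. The choice `t = 0` reduces this
to `Place.le_one_of_isIntegral`. -/
theorem Place.eq_one_of_isIntegral (P : Place F K) {f : K} (hf : f ≠ 0) (h : IsIntegral F f) :
    P.v f = 1 := by
  have key : ∀ g : K, IsIntegral F g → P.v g ≤ 1 := fun g hg =>
    P.le_one_of_isIntegral (t := 0) (by simp) hg.tower_top
  refine le_antisymm (key f h) ?_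
  have := key f⁻¹ h.inv
  rwa [map_inv₀, inv_le_one₀ (zero_lt_iff.2 (by simpa using hf))] at this

/-- A nonzero function without poles has no zeros. -/
theorem Place.eq_one_of_forall_le_one (Q : Place F K) {t : K} (ht : 1 < Q.v t)
    [FiniteDimensional F⟮t⟯ K] [Algebra.IsSeparable F⟮t⟯ K] {f : K} (hf : f ≠ 0)
    (h : ∀ P : Place F K, P.v f ≤ 1) (P : Place F K) : P.v f = 1 := by
  have hk := adjoin_simple_inv (F := F) t
  have h1 : FiniteDimensional F⟮t⁻¹⟯ K := hk ▸ ‹_›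
  have h2 : Algebra.IsSeparable F⟮t⁻¹⟯ K := hk ▸ ‹Algebra.IsSeparable F⟮t⟯ K›
  exact P.eq_one_of_isIntegral hf (isIntegral_of_isIntegral_adjoin_inv Q ht
    ((isIntegral_adjoin_iff t f).2 fun P _ => h P) ((isIntegral_adjoin_iff t⁻¹ f).2 fun P _ => h P))

end Adjoin

end DedekindModels

/-! ### Adding one place to a divisor -/

section RiemannSpaces

variable {F K : Type*} [Field F] [Field K] [Algebra F K]

theorem exp_mul_lt_one_iff {n : ℤ} {x : ℤᵐ⁰} :
    WithZero.exp (-(n + 1)) * x < 1 ↔ x ≤ WithZero.exp n := by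
  induction x using WithZero.expRecOn with
  | zero => simp
  | exp k =>
    rw [← WithZero.exp_zero, ← WithZero.exp_add, WithZero.exp_lt_exp, WithZero.exp_le_exp]
    omega

theorem exp_mul_le_one_iff {n : ℤ} {x : ℤᵐ⁰} :
    WithZero.exp (-n) * x ≤ 1 ↔ x ≤ WithZero.exp n := by
  induction x using WithZero.expRecOn with
  | zero => simp
  | exp k =>
    rw [← WithZero.exp_zero, ← WithZero.exp_add, WithZero.exp_le_exp, WithZero.exp_le_exp]
    omega

theorem lt_exp_iff {n : ℤ} {x : ℤᵐ⁰} : x < WithZero.exp n ↔ x ≤ WithZero.exp (n - 1) := by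
  induction x using WithZero.expRecOn with
  | zero => simp
  | exp k =>
    rw [WithZero.exp_lt_exp, WithZero.exp_le_exp]
    omega

theorem mem_riemannSpace {E : Divisor F K} {f : K} :
    f ∈ riemannSpace E ↔ ∀ P : Place F K, P.v f ≤ WithZero.exp (E P) := Iff.rfl

theorem riemannSpace_mono {E E' : Divisor F K} (h : E ≤ E') :
    riemannSpace E ≤ riemannSpace E' := fun _ hf P =>
  (hf P).trans (WithZero.exp_le_exp.2 (h P))

/-- The leading coefficient map `L(E + P) → O_P / m_P`, whose kernel is `L(E)`. -/
noncomputable def residueMap (E : Divisor F K) (P : Place F K) (t : K)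
    (ht : P.v t = WithZero.exp (-(E P + 1))) :
    riemannSpace (E + Finsupp.single P 1) →ₗ[F] P.ring ⧸ P.maxIdeal where
  toFun f := Ideal.Quotient.mk P.maxIdeal ⟨t * f, by
    have h := f.2 P
    simp only [Finsupp.add_apply, Finsupp.single_eq_same] at h
    change P.v (t * f) ≤ 1
    rwa [map_mul, ht, exp_mul_le_one_iff]⟩
  map_add' f g := by
    rw [← map_add]
    congr 1
    ext
    simp [mul_add]
  map_smul' c f := by
    change _ = Ideal.Quotient.mk P.maxIdeal (c • _)
    congr 1
    ext
    simp

theorem residueMap_eq_mk_iff {E : Divisor F K} {P : Place F K} {t : K}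
    (ht : P.v t = WithZero.exp (-(E P + 1))) (f : riemannSpace (E + Finsupp.single P 1))
    (u : P.ring) :
    residueMap E P t ht f = Ideal.Quotient.mk P.maxIdeal u ↔ P.v (t * f - u) < 1 := by
  refine Ideal.Quotient.eq.trans ?_
  rfl

theorem ker_residueMap {E : Divisor F K} {P : Place F K} {t : K}
    (ht : P.v t = WithZero.exp (-(E P + 1))) :
    LinearMap.ker (residueMap E P t ht) =
      (riemannSpace E).comap (riemannSpace (E + Finsupp.single P 1)).subtype := by
  ext f
  rw [LinearMap.mem_ker, ← map_zero (Ideal.Quotient.mk P.maxIdeal), residueMap_eq_mk_iff,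
    ZeroMemClass.coe_zero, sub_zero, map_mul, ht, exp_mul_lt_one_iff, Submodule.mem_comap,
    Submodule.subtype_apply, mem_riemannSpace]
  refine ⟨fun h P' => ?_, fun h => h P⟩
  by_cases hP : P' = P
  · rwa [hP]
  · simpa [Finsupp.single_apply, Ne.symm hP] using f.2 P'

theorem le_add_single (E : Divisor F K) (P : Place F K) {n : ℤ} (hn : 0 ≤ n) :
    E ≤ E + Finsupp.single P n :=
  le_add_of_nonneg_right (Finsupp.single_nonneg.2 hn)

noncomputable def kerResidueMapEquiv {E : Divisor F K} {P : Place F K} {t : K}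
    (ht : P.v t = WithZero.exp (-(E P + 1))) :
    LinearMap.ker (residueMap E P t ht) ≃ₗ[F] riemannSpace E :=
  (LinearEquiv.ofEq _ _ (ker_residueMap ht)).trans
    (Submodule.comapSubtypeEquivOfLe (riemannSpace_mono (le_add_single E P zero_le_one)))

/-- The quotient `L(E + P) / L(E)` embeds into the residue field of `P`. -/
theorem finiteDimensional_riemannSpace_add_single (E : Divisor F K) (P : Place F K)
    [FiniteDimensional F (P.ring ⧸ P.maxIdeal)] [FiniteDimensional F (riemannSpace E)] :
    FiniteDimensional F (riemannSpace (E + Finsupp.single P 1)) := by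
  obtain ⟨t, ht⟩ := P.surjective (WithZero.exp (-(E P + 1)))
  have h1 : Module.Finite F (LinearMap.ker (residueMap E P t ht)) :=
    Module.Finite.equiv (kerResidueMapEquiv ht).symm
  have h2 : Module.Finite F (LinearMap.range (residueMap E P t ht)) := inferInstance
  have h3 := Module.Finite.equiv (residueMap E P t ht).quotKerEquivRange.symm
  exact Module.Finite.of_submodule_quotient (LinearMap.ker (residueMap E P t ht))

theorem ell_add_single (E : Divisor F K) (P : Place F K)
    [FiniteDimensional F (P.ring ⧸ P.maxIdeal)] [FiniteDimensional F (riemannSpace E)]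
    {t : K} (ht : P.v t = WithZero.exp (-(E P + 1)))
    (hsurj : Function.Surjective (residueMap E P t ht)) :
    ell (E + Finsupp.single P 1) = ell E + P.degree := by
  have := finiteDimensional_riemannSpace_add_single E P
  have h := (residueMap E P t ht).finrank_range_add_finrank_ker
  rw [LinearMap.range_eq_top.2 hsurj, finrank_top, (kerResidueMapEquiv ht).finrank_eq] at h
  rw [ell, ell, Place.degree, ← h, add_comm]

theorem Place.IsRational.finiteDimensional {P : Place F K} (hP : P.IsRational) :
    FiniteDimensional F (P.ring ⧸ P.maxIdeal) :=
  FiniteDimensional.of_finrank_pos (by rw [show Module.finrank F _ = 1 from hP]; exact one_pos)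

/-- Functions have values at the rational points where they have no pole. -/
theorem Place.IsRational.exists_hasValue {P : Place F K} (hP : P.IsRational) {f : K}
    (hf : P.v f ≤ 1) : ∃ c : F, P.HasValue f c := by
  have hne : (1 : P.ring ⧸ P.maxIdeal) ≠ 0 := by
    intro h
    have h1 : (1 : P.ring) ∈ P.maxIdeal := Ideal.Quotient.eq_zero_iff_mem.1 h
    exact lt_irrefl (1 : ℤᵐ⁰) (by simpa using (show P.v ((1 : P.ring) : K) < 1 from h1))
  obtain ⟨c, hc⟩ := (finrank_eq_one_iff_of_nonzero' 1 hne).1 hP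
    (Ideal.Quotient.mk P.maxIdeal ⟨f, hf⟩)
  refine ⟨c, ?_⟩
  have h2 : Ideal.Quotient.mk P.maxIdeal ⟨f, hf⟩ =
      Ideal.Quotient.mk P.maxIdeal (algebraMap F P.ring c) := by
    rw [← hc, Algebra.algebraMap_eq_smul_one]
    rfl
  exact Ideal.Quotient.eq.1 h2

/-- Cancellation of leading terms: `c` is the value of `f / h` at `P`. -/
theorem Place.IsRational.exists_sub_smul_lt {P : Place F K} (hP : P.IsRational) {f h : K}
    (hh : h ≠ 0) (hf : P.v f ≤ P.v h) : ∃ c : F, P.v (f - c • h) < P.v h := by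
  have h0 : 0 < P.v h := zero_lt_iff.2 (by simpa using hh)
  obtain ⟨c, hc⟩ := hP.exists_hasValue (f := f / h) (by
    rw [map_div₀]
    exact (div_le_one₀ h0).2 hf)
  refine ⟨c, ?_⟩
  have e : f - c • h = (f / h - algebraMap F K c) * h := by
    rw [Algebra.smul_def]
    field_simp
  rw [e, map_mul]
  exact mul_lt_of_lt_one_left h0 hc

end RiemannSpaces

/-! ### Strong approximation outside `Q` -/

section Approximation

variable {F K : Type*} [Field F] [Field K] [Algebra F K]

/-- `R` is the ring of functions regular outside `Q`. -/
def IsAffineModel (Q : Place F K) (R : Type*) [CommRing R] [Algebra R K] : Prop :=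
  ∀ f : K, f ∈ (algebraMap R K).range ↔ ∀ P ≠ Q, P.v f ≤ 1

variable {R : Type*} [CommRing R] [IsDedekindDomain R] [Algebra R K] [IsFractionRing R K]
  {Q : Place F K}

theorem IsAffineModel.exists_valuation_eq (hR : IsAffineModel Q R) {P : Place F K} (hP : P ≠ Q) :
    ∃ p : HeightOneSpectrum R, P.v = p.valuation K :=
  P.exists_valuation_eq fun r => (hR _).1 ⟨r, rfl⟩ P hP

/-- Chinese remainder theorem: the prime of `P` is coprime to the product of the `N`-th powers of
the primes of `T`, and `e` is the second summand in a decomposition of `1`. -/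
theorem IsAffineModel.exists_approx_one (hR : IsAffineModel Q R) {P : Place F K} (hP : P ≠ Q)
    (T : Finset (Place F K)) (hPT : P ∉ T) (hQT : Q ∉ T) (N : ℕ) :
    ∃ e : K, (∀ P' ≠ Q, P'.v e ≤ 1) ∧ P.v (e - 1) < 1 ∧
      ∀ P' ∈ T, P'.v e ≤ WithZero.exp (-(N : ℤ)) := by
  -- At `Q` an arbitrary prime is chosen, only to make `p` defined on all places.
  have hp : ∀ P' : Place F K, ∃ p : HeightOneSpectrum R, P' ≠ Q → P'.v = p.valuation K := by
    intro P'
    by_cases h : P' = Q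
    · obtain ⟨p, -⟩ := hR.exists_valuation_eq hP
      exact ⟨p, fun h' => absurd h h'⟩
    · obtain ⟨p, hp⟩ := hR.exists_valuation_eq h
      exact ⟨p, fun _ => hp⟩
  choose p hp using hp
  have hcop : IsCoprime (p P).asIdeal (∏ P' ∈ T, (p P').asIdeal ^ N) := by
    refine IsCoprime.prod_right fun P' hP' => IsCoprime.pow_right ?_
    refine Ideal.isCoprime_of_isMaximal fun h => ?_
    have h1 : p P = p P' := HeightOneSpectrum.ext h
    have h2 : P' ≠ Q := fun h => hQT (h ▸ hP')
    exact hPT (Place.ext ((hp P hP).trans (h1 ▸ (hp P' h2).symm)) ▸ hP')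
  obtain ⟨a, ha, b, hb, hab⟩ := Ideal.isCoprime_iff_exists.1 hcop
  refine ⟨algebraMap R K b, (hR _).1 ⟨b, rfl⟩, ?_, fun P' hP' => ?_⟩
  · rw [← map_one (algebraMap R K), ← hab, ← map_sub, sub_add_cancel_right, map_neg,
      Valuation.map_neg, hp P hP]
    exact ((p P).valuation_lt_one_iff_mem a).2 ha
  · rw [hp P' fun h => hQT (h ▸ hP'), HeightOneSpectrum.valuation_of_algebraMap,
      HeightOneSpectrum.intValuation_le_pow_iff_mem]
    exact (Ideal.prod_le_inf.trans (Finset.inf_le hP')) hb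

/-- Different places come from different primes, and only finitely many primes are poles of `g`. -/
theorem IsAffineModel.finite_poles (hR : IsAffineModel Q R) (g : K) :
    {P : Place F K | P ≠ Q ∧ 1 < P.v g}.Finite := by
  have hp : ∀ P : {P : Place F K | P ≠ Q ∧ 1 < P.v g}, ∃ p : HeightOneSpectrum R,
      P.1.v = p.valuation K := fun P => hR.exists_valuation_eq P.2.1
  choose p hp using hp
  have hfin : (HeightOneSpectrum.Support R g).Finite := HeightOneSpectrum.Support.finite R g
  have := hfin.to_subtype
  have := Finite.of_injective
    (fun P => (⟨p P, by
      change 1 < (p P).valuation K g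
      rw [← hp P]
      exact P.2.2⟩ : HeightOneSpectrum.Support R g))
    fun P P' h => Subtype.ext (Place.ext (by
      rw [hp P, hp P', show p P = p P' from congrArg Subtype.val h]))
  exact Set.toFinite _

/-- Strong approximation outside `Q`. -/
theorem IsAffineModel.exists_approx (hR : IsAffineModel Q R) {P : Place F K} (hP : P ≠ Q)
    (E : Divisor F K) {g : K} (hg : P.v g ≤ WithZero.exp (E P + 1)) :
    ∃ f : K, P.v (f - g) ≤ WithZero.exp (E P) ∧
      ∀ P' ≠ Q, P'.v f ≤ WithZero.exp ((E + Finsupp.single P 1 : Divisor F K) P') := by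
  classical
  by_cases hg0 : g = 0
  · exact ⟨0, by simp [hg0], by simp⟩
  let T : Finset (Place F K) := ((hR.finite_poles g).toFinset ∪ E.support) \ {P, Q}
  have hN : ∃ N : ℕ, ∀ P' ∈ T, P'.v g * WithZero.exp (-(N : ℤ)) ≤ WithZero.exp (E P') := by
    -- The sum serves as a common upper bound for the vanishing orders needed on `T`.
    refine ⟨∑ P' ∈ T, (WithZero.log (P'.v g) - E P').toNat, fun P' hP' => ?_⟩
    have h1 := Finset.single_le_sum (f := fun P' : Place F K => (WithZero.log (P'.v g) - E P').toNat)
      (fun _ _ => Nat.zero_le _) hP'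
    obtain ⟨n, hn⟩ := P'.exists_eq_exp hg0
    simp only [hn, WithZero.log_exp] at h1
    rw [hn, ← WithZero.exp_add, WithZero.exp_le_exp]
    omega
  obtain ⟨N, hN⟩ := hN
  obtain ⟨e, he1, he2, he3⟩ := hR.exists_approx_one hP T (by simp [T]) (by simp [T]) N
  -- At `P` the error `g (e - 1)` gains one order; on `T` the zeros of `e` absorb the excess poles
  -- of `g`.
  refine ⟨g * e, ?_, fun P' hP' => ?_⟩
  · rw [← mul_sub_one, map_mul]
    calc P.v g * P.v (e - 1) ≤ WithZero.exp (E P + 1) * WithZero.exp (-1) :=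
          mul_le_mul' hg (lt_one_iff_le_exp_neg_one.1 he2)
      _ = _ := by rw [← WithZero.exp_add]; simp
  · rw [map_mul]
    by_cases h : P' = P
    · subst h
      simpa using (mul_le_of_le_one_right' (he1 _ hP')).trans hg
    have hE : (E + Finsupp.single P 1 : Divisor F K) P' = E P' := by simp [Ne.symm h]
    rw [hE]
    by_cases hT : P' ∈ T
    · exact (mul_le_mul_right (he3 P' hT) _).trans (hN P' hT)
    · simp only [T, Finset.mem_sdiff, Finset.mem_union, Set.Finite.mem_toFinset, Set.mem_ofPred_eq,
        Finsupp.mem_support_iff, Finset.mem_insert, Finset.mem_singleton, h, hP'] at hT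
      push Not at hT
      have hT1 : P'.v g ≤ 1 := by
        by_contra h1
        simp_all
      have hT2 : E P' = 0 := by
        by_contra h1
        simp_all
      rw [hT2, WithZero.exp_zero]
      exact mul_le_one' hT1 (he1 P' hP')

end Approximation

open Filter

/-! ### Weak Riemann–Roch and the sign of the degree -/

section Degree

variable {F K : Type*} [Field F] [Field K] [Algebra F K]

theorem Divisor.deg_add (E E' : Divisor F K) : (E + E').deg = E.deg + E'.deg :=
  Finsupp.sum_add_index' (by simp) fun _ _ _ => add_mul _ _ _

theorem Divisor.deg_single (P : Place F K) (n : ℤ) :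
    Divisor.deg (Finsupp.single P n) = n * P.degree :=
  Finsupp.sum_single_index (by simp)

/-- Nonzero functions without poles have no zeros. -/
def HasOnlyConstants (F K : Type*) [Field F] [Field K] [Algebra F K] : Prop :=
  ∀ f : K, f ≠ 0 → (∀ P : Place F K, P.v f ≤ 1) → ∀ P : Place F K, P.v f = 1

variable {Q : Place F K}

theorem mem_riemannSpace_single {n : ℤ} {f : K} :
    f ∈ riemannSpace (Finsupp.single Q n) ↔
      (∀ P ≠ Q, P.v f ≤ 1) ∧ Q.v f ≤ WithZero.exp n := by
  refine ⟨fun h => ⟨fun P hP => ?_, by simpa using h Q⟩, fun h P => ?_⟩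
  · simpa [Finsupp.single_apply, hP.symm] using h P
  · by_cases hP : P = Q
    · subst hP
      simpa using h.2
    · simpa [Finsupp.single_apply, Ne.symm hP] using h.1 P hP

theorem HasOnlyConstants.one_le_v_of_regular (hc : HasOnlyConstants F K) {f : K} (hf : f ≠ 0)
    (h : ∀ P ≠ Q, P.v f ≤ 1) : 1 ≤ Q.v f := by
  by_contra! hlt
  refine hlt.ne (hc f hf (fun P => ?_) Q)
  by_cases hP : P = Q
  · exact hP ▸ hlt.le
  · exact h P hP

theorem HasOnlyConstants.finiteDimensional_single (hc : HasOnlyConstants F K)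
    (hQ : Q.IsRational) (j : ℤ) : FiniteDimensional F (riemannSpace (Finsupp.single Q j)) := by
  -- The shift by one starts the induction at `L(-Q)`, which is zero because a regular function with
  -- a zero vanishes identically.
  have key : ∀ n : ℕ, FiniteDimensional F (riemannSpace (Finsupp.single Q ((n : ℤ) - 1))) := by
    intro n
    induction n with
    | zero =>
      have : riemannSpace (Finsupp.single Q (((0 : ℕ) : ℤ) - 1)) = ⊥ := by
        refine (Submodule.eq_bot_iff _).2 fun f hf => ?_
        rw [mem_riemannSpace_single] at hf
        by_contra hf0
        refine (hc.one_le_v_of_regular hf0 hf.1).not_gt (lt_one_iff_le_exp_neg_one.2 ?_)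
        simpa using hf.2
      rw [this]
      infer_instance
    | succ n ih =>
      have := hQ.finiteDimensional
      have := finiteDimensional_riemannSpace_add_single (Finsupp.single Q ((n : ℤ) - 1)) Q
      rw [← Finsupp.single_add] at this
      rwa [sub_add_eq_add_sub, ← Nat.cast_succ] at this
  have := key (j.toNat + 1)
  refine Submodule.finiteDimensional_of_le (S₂ := riemannSpace
    (Finsupp.single Q (((j.toNat + 1 : ℕ) : ℤ) - 1))) (riemannSpace_mono ?_)
  exact Finsupp.single_mono (by omega)

variable {R : Type*} [CommRing R] [IsDedekindDomain R] [Algebra R K] [IsFractionRing R K]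

/-- All large integers are pole orders at `Q`. -/
theorem IsAffineModel.exists_poleOrder_eq (hR : IsAffineModel Q R) (hc : HasOnlyConstants F K) :
    ∃ j₀ : ℕ, ∀ j ≥ j₀, ∃ f : K, (∀ P ≠ Q, P.v f ≤ 1) ∧ Q.v f = WithZero.exp (j : ℤ) := by
  obtain ⟨u, hu⟩ := Q.surjective (WithZero.exp 1)
  -- Writing a function of pole order `1` as `a / b` gives regular functions of consecutive pole
  -- orders `s + 1` and `s`; these generate every integer from `s * s` on.
  obtain ⟨a, b, hb, rfl⟩ := IsFractionRing.div_surjective (A := R) u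
  have hb0 : algebraMap R K b ≠ 0 :=
    IsFractionRing.to_map_ne_zero_of_mem_nonZeroDivisors hb
  have hregA := (hR _).1 ⟨a, rfl⟩
  have hregB := (hR _).1 ⟨b, rfl⟩
  generalize algebraMap R K a = a at *
  generalize algebraMap R K b = b at *
  obtain ⟨s, hs⟩ := Q.exists_eq_exp hb0
  have hs0 : 0 ≤ s := by
    have := hc.one_le_v_of_regular hb0 hregB
    rwa [hs, ← WithZero.exp_zero, WithZero.exp_le_exp] at this
  lift s to ℕ using hs0
  have ha : Q.v a = WithZero.exp ((s : ℤ) + 1) := by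
    rw [map_div₀, div_eq_iff (by simpa using hb0), hs, ← WithZero.exp_add] at hu
    rw [hu, add_comm]
  have hreg : ∀ i k : ℕ, ∀ P ≠ Q, P.v (a ^ i * b ^ k) ≤ 1 := fun i k P hP => by
    rw [map_mul, map_pow, map_pow]
    exact mul_le_one' (pow_le_one' (hregA P hP) _) (pow_le_one' (hregB P hP) _)
  have hval : ∀ i k : ℕ, Q.v (a ^ i * b ^ k) = WithZero.exp ((i * (s + 1) + k * s : ℕ) : ℤ) := by
    intro i k
    rw [map_mul, map_pow, map_pow, ha, hs, ← WithZero.exp_nsmul, ← WithZero.exp_nsmul,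
      ← WithZero.exp_add]
    simp
  refine ⟨s * s, fun j hj => ?_⟩
  suffices h : ∃ i k : ℕ, i * (s + 1) + k * s = j by
    obtain ⟨i, k, h⟩ := h
    exact ⟨_, hreg i k, by rw [hval, h]⟩
  rcases Nat.eq_zero_or_pos s with rfl | hs0
  · exact ⟨j, 0, by simp⟩
  · have h1 : j % s < s := Nat.mod_lt _ hs0
    have h2 : s ≤ j / s := (Nat.le_div_iff_mul_le hs0).2 hj
    -- The remainder of `j` modulo `s` is the number of summands `s + 1`; the subtraction is exact
    -- since `j % s < s ≤ j / s`.
    refine ⟨j % s, j / s - j % s, ?_⟩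
    have h3 := Nat.div_add_mod j s
    obtain ⟨d, hd⟩ := Nat.exists_eq_add_of_le (h1.le.trans h2)
    rw [hd] at h3 ⊢
    rw [Nat.add_sub_cancel_left]
    nlinarith

/-- Let `c` be regular outside `Q`, vanish at `P` and have pole order `a` at `Q`. Multiples of `c`
have every pole order above `j₀ + a` and vanish at `P`, so subtracting them lowers the pole order at
`Q` without changing the residue at `P`. Hence `L((j₀ + a)Q)` maps onto the residue field. -/
theorem IsAffineModel.finiteDimensional_residueField (hR : IsAffineModel Q R)
    (hc : HasOnlyConstants F K) (hQ : Q.IsRational) (P : Place F K) :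
    FiniteDimensional F (P.ring ⧸ P.maxIdeal) := by
  by_cases hP : P = Q
  · exact hP ▸ hQ.finiteDimensional
  obtain ⟨c, hc0, hcreg, hcP⟩ : ∃ c : K, c ≠ 0 ∧ (∀ P' ≠ Q, P'.v c ≤ 1) ∧ P.v c < 1 := by
    obtain ⟨p, hp⟩ := hR.exists_valuation_eq hP
    obtain ⟨r, hr, hr0⟩ := Submodule.exists_mem_ne_zero_of_ne_bot p.ne_bot
    refine ⟨algebraMap R K r, by simpa using hr0, (hR _).1 ⟨r, rfl⟩, ?_⟩
    rw [hp]
    exact (p.valuation_lt_one_iff_mem r).2 hr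
  obtain ⟨a, ha⟩ := Q.exists_eq_exp hc0
  have ha0 : 0 ≤ a := by
    have := hc.one_le_v_of_regular hc0 hcreg
    rwa [ha, ← WithZero.exp_zero, WithZero.exp_le_exp] at this
  lift a to ℕ using ha0
  obtain ⟨j₀, hj₀⟩ := hR.exists_poleOrder_eq hc
  have key : ∀ n : ℕ, ∀ f : K, (∀ P' ≠ Q, P'.v f ≤ 1) → Q.v f ≤ WithZero.exp (n : ℤ) →
      ∃ f' ∈ riemannSpace (Finsupp.single Q ((j₀ + a : ℕ) : ℤ)), P.v (f - f') < 1 := by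
    intro n
    induction n with
    | zero =>
      intro f hf1 hf2
      exact ⟨f, mem_riemannSpace_single.2 ⟨hf1, hf2.trans (WithZero.exp_le_exp.2 (by omega))⟩,
        by simp⟩
    | succ n ih =>
      intro f hf1 hf2
      by_cases hn : n + 1 ≤ j₀ + a
      · exact ⟨f, mem_riemannSpace_single.2
          ⟨hf1, hf2.trans (WithZero.exp_le_exp.2 (by exact_mod_cast hn))⟩, by simp⟩
      obtain ⟨h, hh1, hh2⟩ := hj₀ (n + 1 - a) (by omega)
      have hch : Q.v (c * h) = WithZero.exp ((n + 1 : ℕ) : ℤ) := by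
        rw [map_mul, ha, hh2, ← WithZero.exp_add]
        congr 1
        omega
      have hch0 : c * h ≠ 0 := by
        intro h0
        rw [h0, map_zero] at hch
        exact WithZero.exp_ne_zero hch.symm
      obtain ⟨b, hb⟩ := hQ.exists_sub_smul_lt hch0 (hch ▸ hf2)
      obtain ⟨f', hf', hlt⟩ := ih (f - b • (c * h)) (fun P' hP' => by
        refine P'.v.map_sub_le (hf1 P' hP') ((P'.v_smul_le _ _).trans ?_)
        rw [map_mul]
        exact mul_le_one' (hcreg P' hP') (hh1 P' hP')) (by
          rw [hch, lt_exp_iff] at hb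
          simpa using hb)
      refine ⟨f', hf', ?_⟩
      have e : f - f' = (f - b • (c * h) - f') + b • (c * h) := by ring
      rw [e]
      refine P.v.map_add_lt hlt ((P.v_smul_le _ _).trans_lt ?_)
      rw [map_mul]
      exact (mul_le_of_le_one_right' (hh1 P hP)).trans_lt hcP
  -- The coefficient of `E` at `P` is `-1`, so the residue map for `t = 1` is reduction modulo `P`.
  set E : Divisor F K := Finsupp.single Q ((j₀ + a : ℕ) : ℤ) - Finsupp.single P 1 with hE
  have hEP : E + Finsupp.single P 1 = Finsupp.single Q ((j₀ + a : ℕ) : ℤ) := by simp [hE]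
  have ht : P.v 1 = WithZero.exp (-(E P + 1)) := by
    simp [hE, Ne.symm hP]
  have hfin := hc.finiteDimensional_single hQ ((j₀ + a : ℕ) : ℤ)
  rw [← hEP] at hfin key
  refine Module.Finite.of_surjective (residueMap E P 1 ht) fun x => ?_
  obtain ⟨u, rfl⟩ := Ideal.Quotient.mk_surjective x
  obtain ⟨f, hf1, hf2⟩ := hR.exists_approx hP (Finsupp.single P (-1)) (g := (u : K))
    (by simpa using show P.v (u : K) ≤ 1 from u.2)
  rw [← Finsupp.single_add] at hf2
  simp only [Finsupp.single_eq_same, neg_add_cancel, Finsupp.single_zero, Finsupp.coe_zero,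
    Pi.zero_apply, WithZero.exp_zero] at hf1 hf2
  obtain ⟨n, hn⟩ : ∃ n : ℕ, Q.v f ≤ WithZero.exp (n : ℤ) := by
    by_cases hf0 : f = 0
    · exact ⟨0, by simp [hf0]⟩
    · obtain ⟨n, hn⟩ := Q.exists_eq_exp hf0
      exact ⟨n.toNat, hn ▸ WithZero.exp_le_exp.2 n.self_le_toNat⟩
  obtain ⟨f', hf', hlt⟩ := key n f hf2 hn
  refine ⟨⟨f', hf'⟩, (residueMap_eq_mk_iff ht _ _).2 ?_⟩
  have e : 1 * f' - (u : K) = (f - u) - (f - f') := by ring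
  rw [e]
  exact P.v.map_sub_lt (lt_one_iff_le_exp_neg_one.2 hf1) hlt

/-- Strong approximation lifts each of finitely many generators of the residue field to a function
with the required behaviour outside `Q`. For large `j` their poles at `Q` are allowed, and the
residue map is onto. -/
theorem IsAffineModel.eventually_ell_add_single (hR : IsAffineModel Q R) {P : Place F K}
    (hP : P ≠ Q) [FiniteDimensional F (P.ring ⧸ P.maxIdeal)] (E : Divisor F K)
    (hfin : ∀ j : ℤ, FiniteDimensional F (riemannSpace (E + Finsupp.single Q j))) :
    ∀ᶠ j : ℤ in atTop, ell (E + Finsupp.single Q j + Finsupp.single P 1) =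
      ell (E + Finsupp.single Q j) + P.degree := by
  obtain ⟨t, ht⟩ := P.surjective (WithZero.exp (-(E P + 1)))
  have ht0 : t ≠ 0 := by
    intro h0
    rw [h0, map_zero] at ht
    exact WithZero.exp_ne_zero ht.symm
  have ht' : ∀ j : ℤ, P.v t = WithZero.exp (-((E + Finsupp.single Q j : Divisor F K) P + 1)) := by
    intro j
    rw [ht]
    simp [Ne.symm hP]
  obtain ⟨s, hs⟩ := Module.Finite.fg_top (R := F) (M := P.ring ⧸ P.maxIdeal)
  have key : ∀ x ∈ s, ∀ᶠ j : ℤ in atTop, x ∈ LinearMap.range (residueMap _ P t (ht' j)) := by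
    intro x _
    obtain ⟨u, rfl⟩ := Ideal.Quotient.mk_surjective x
    obtain ⟨f, hf1, hf2⟩ := hR.exists_approx hP E (g := (u : K) / t) (by
      rw [map_div₀, ht, WithZero.exp_neg, div_inv_eq_mul]
      exact mul_le_of_le_one_left' u.2)
    have hfQ : ∀ᶠ j : ℤ in atTop, Q.v f ≤ WithZero.exp (E Q + j) := by
      by_cases hf0 : f = 0
      · simp [hf0]
      · obtain ⟨n, hn⟩ := Q.exists_eq_exp hf0
        filter_upwards [eventually_ge_atTop (n - E Q)] with j hj
        rw [hn, WithZero.exp_le_exp]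
        omega
    filter_upwards [hfQ] with j hj
    refine ⟨⟨f, fun P' => ?_⟩, (residueMap_eq_mk_iff (ht' j) _ _).2 ?_⟩
    · by_cases hP' : P' = Q
      · subst hP'
        simpa [Finsupp.single_apply, hP] using hj
      · refine (hf2 P' hP').trans (le_of_eq ?_)
        simp [Ne.symm hP']
    · have e : t * f - (u : K) = t * (f - u / t) := by field_simp
      rw [e, map_mul, ht, exp_mul_lt_one_iff]
      exact hf1
  filter_upwards [(Filter.eventually_all_finset s).2 key] with j hj
  refine ell_add_single _ P (ht' j) (LinearMap.range_eq_top.1 (top_le_iff.1 ?_))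
  rw [← hs, Submodule.span_le]
  exact hj

/-- The weak form of the Riemann–Roch theorem: `ℓ(E + jQ) = j + deg E + g` for all large `j`, with
a constant `g` that does not depend on `E`. -/
theorem IsAffineModel.exists_eventually_ell_eq (hR : IsAffineModel Q R)
    (hc : HasOnlyConstants F K) (hQ : Q.IsRational) :
    ∃ g : ℤ, ∀ E : Divisor F K,
      (∀ j : ℤ, FiniteDimensional F (riemannSpace (E + Finsupp.single Q j))) ∧
      ∀ᶠ j : ℤ in atTop, (ell (E + Finsupp.single Q j) : ℤ) = j + E.deg + g := by
  have hres := hR.finiteDimensional_residueField hc hQ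
  have hfin0 := hc.finiteDimensional_single hQ
  obtain ⟨j₀, hj₀⟩ := hR.exists_poleOrder_eq hc
  have hstep : ∀ j : ℤ, j₀ ≤ j → ell (Finsupp.single Q (j + 1)) = ell (Finsupp.single Q j) + 1 := by
    intro j hj
    have ht := Q.surjective (WithZero.exp (-((Finsupp.single Q j : Divisor F K) Q + 1)))
    obtain ⟨t, ht⟩ := ht
    rw [Finsupp.single_add, ell_add_single _ Q ht ?_, show Q.degree = 1 from hQ]
    obtain ⟨f, hf1, hf2⟩ := hj₀ (j + 1).toNat (by omega)
    rw [Int.toNat_of_nonneg (by omega)] at hf2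
    have hmem : f ∈ riemannSpace (Finsupp.single Q j + Finsupp.single Q 1) := by
      rw [← Finsupp.single_add, mem_riemannSpace_single]
      exact ⟨hf1, hf2.le⟩
    -- The residue field of `Q` has dimension one, so one nonzero image gives surjectivity.
    have hne : residueMap _ Q t ht ⟨f, hmem⟩ ≠ 0 := by
      intro h0
      rw [← map_zero (Ideal.Quotient.mk Q.maxIdeal), residueMap_eq_mk_iff] at h0
      simp [ht, hf2, ← WithZero.exp_add] at h0
    intro x
    obtain ⟨c, rfl⟩ := (finrank_eq_one_iff_of_nonzero' _ hne).1 hQ x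
    exact ⟨c • ⟨f, hmem⟩, map_smul _ _ _⟩
  refine ⟨ell (Finsupp.single Q (j₀ : ℤ)) - j₀, fun E => ?_⟩
  generalize hg : (ell (Finsupp.single Q (j₀ : ℤ)) - j₀ : ℤ) = g
  let S : Divisor F K → Prop := fun E =>
    (∀ j : ℤ, FiniteDimensional F (riemannSpace (E + Finsupp.single Q j))) ∧
      ∀ᶠ j : ℤ in atTop, (ell (E + Finsupp.single Q j) : ℤ) = j + E.deg + g
  have hcomm : ∀ (E : Divisor F K) (P : Place F K) (j : ℤ),
      E + Finsupp.single P 1 + Finsupp.single Q j = E + Finsupp.single Q j + Finsupp.single P 1 :=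
    fun E P j => add_right_comm _ _ _
  -- The equivalence allows both adding and removing places, so every divisor is reached from `0`.
  -- For `P = Q` it is a shift of `j`; otherwise both sides of the formula eventually grow by the
  -- degree of `P`.
  have hS : ∀ E P, S E ↔ S (E + Finsupp.single P 1) := by
    intro E P
    have hle : (∀ j : ℤ, FiniteDimensional F (riemannSpace (E + Finsupp.single Q j))) ↔
        ∀ j : ℤ, FiniteDimensional F
          (riemannSpace (E + Finsupp.single P 1 + Finsupp.single Q j)) := by
      refine forall_congr' fun j => ?_
      rw [hcomm]
      refine ⟨fun h => finiteDimensional_riemannSpace_add_single _ P, fun h => ?_⟩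
      exact Submodule.finiteDimensional_of_le (riemannSpace_mono (le_add_single _ P zero_le_one))
    simp only [S]
    rw [← hle]
    refine and_congr_right fun hfin => ?_
    by_cases hP : P = Q
    · subst hP
      have e : ∀ j : ℤ, E + Finsupp.single P 1 + Finsupp.single P j =
          E + Finsupp.single P (j + 1) := fun j => by
        rw [add_assoc, ← Finsupp.single_add, add_comm 1 j]
      simp only [e, Divisor.deg_add, Divisor.deg_single, show P.degree = 1 from hQ,
        eventually_atTop]
      constructor
      · rintro ⟨a, ha⟩
        exact ⟨a, fun b hb => by rw [ha (b + 1) (by omega)]; push_cast; ring⟩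
      · rintro ⟨a, ha⟩
        refine ⟨a + 1, fun b hb => ?_⟩
        have := ha (b - 1) (by omega)
        rw [sub_add_cancel] at this
        rw [this]
        push_cast
        ring
    · refine eventually_congr ?_
      filter_upwards [hR.eventually_ell_add_single hP E hfin] with j hj
      rw [hcomm, hj, Divisor.deg_add, Divisor.deg_single]
      push_cast
      constructor <;> intro h <;> linarith
  have hSn : ∀ (n : ℤ) E P, S E → S (E + Finsupp.single P n) := by
    intro n E P hE
    induction n using Int.induction_on with
    | zero => simpa using hE
    | succ n ih =>
      rw [Finsupp.single_add, ← add_assoc]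
      exact (hS _ P).1 ih
    | pred n ih =>
      rw [hS _ P, add_assoc, ← Finsupp.single_add, sub_add_cancel]
      exact ih
  have hS0 : S 0 := by
    refine ⟨fun j => by rw [zero_add]; exact hfin0 j, ?_⟩
    filter_upwards [eventually_ge_atTop (j₀ : ℤ)] with j hj
    induction j, hj using Int.leInduction with
    | base => simp [← hg, Divisor.deg]
    | succ j hj ih =>
      rw [zero_add] at ih ⊢
      rw [hstep j hj]
      push_cast
      rw [ih]
      ring
  change S E
  induction E using Finsupp.induction with
  | zero => exact hS0
  | single_add P n E _ _ ih =>
    rw [add_comm]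
    exact hSn n E P ih

theorem IsAffineModel.finiteDimensional_riemannSpace (hR : IsAffineModel Q R)
    (hc : HasOnlyConstants F K) (hQ : Q.IsRational) (E : Divisor F K) :
    FiniteDimensional F (riemannSpace E) := by
  obtain ⟨g, hg⟩ := hR.exists_eventually_ell_eq hc hQ
  have := (hg E).1 0
  rwa [Finsupp.single_zero, add_zero] at this

/-- `L(E) = 0` when `deg E < 0`. -/
theorem IsAffineModel.deg_nonneg (hR : IsAffineModel Q R)
    (hc : HasOnlyConstants F K) (hQ : Q.IsRational) {E : Divisor F K} {f : K} (hf : f ≠ 0)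
    (hfE : f ∈ riemannSpace E) : 0 ≤ E.deg := by
  obtain ⟨g, hg⟩ := hR.exists_eventually_ell_eq hc hQ
  obtain ⟨j, h0, hE⟩ := ((hg 0).2.and (hg E).2).exists
  have := (hg E).1 j
  -- Multiplication by `f` injects `L(jQ)` into `L(E + jQ)`; the constants `j + g` cancel in the
  -- comparison of dimensions.
  have hmul : ∀ h ∈ riemannSpace (0 + Finsupp.single Q j),
      LinearMap.mulLeft F f h ∈ riemannSpace (E + Finsupp.single Q j) := by
    intro h hh P
    rw [LinearMap.mulLeft_apply, map_mul, Finsupp.add_apply, WithZero.exp_add]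
    exact mul_le_mul' (hfE P) (by simpa using hh P)
  have hle := LinearMap.finrank_le_finrank_of_injective
    (f := (LinearMap.mulLeft F f).restrict hmul) fun a b hab => Subtype.ext
      (mul_left_cancel₀ hf (congrArg Subtype.val hab))
  have hle' : (ell (0 + Finsupp.single Q j) : ℤ) ≤ ell (E + Finsupp.single Q j) := by
    exact_mod_cast hle
  rw [h0, hE] at hle'
  simp only [Divisor.deg, Finsupp.sum_zero_index] at hle' ⊢
  linarith

end Degree

/-! ### A separating coordinate function -/

section SeparatedVariables

open IntermediateField

/-- Such an `A` is a polynomial in `X ^ p`, and its coefficients are `p`-th powers. -/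
theorem exists_eq_pow_of_derivative_eq_zero {L : Type*} [Field L] (p : ℕ) [Fact p.Prime]
    [CharP L p] [PerfectField L] {A : L[X]} (hA : Polynomial.derivative A = 0) :
    ∃ A' : L[X], A = A' ^ p := by
  have : PerfectRing L p := PerfectField.toPerfectRing p
  exact ⟨_, (Polynomial.expand_contract p hA (Fact.out : p.Prime).ne_zero).symm.trans
    (polynomial_expand_eq L p _)⟩

variable {F : Type*} [Field F]

/-- Otherwise `A(Y) - B(X)` would be a `p`-th power over the algebraic closure. -/
theorem AbsolutelyIrreducible.derivative_ne_zero {A B : F[X]} [Finite F]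
    (h : AbsolutelyIrreducible A B) :
    Polynomial.derivative A ≠ 0 ∨ Polynomial.derivative B ≠ 0 := by
  by_contra! hAB
  obtain ⟨p, hp⟩ := CharP.exists F
  have hprime : Fact p.Prime := ⟨CharP.char_is_prime F p⟩
  set L := AlgebraicClosure F
  have hL : CharP L p := charP_of_injective_algebraMap (algebraMap F L).injective p
  obtain ⟨A', hA'⟩ := exists_eq_pow_of_derivative_eq_zero p (A := A.map (algebraMap F L))
    (by rw [Polynomial.derivative_map, hAB.1, Polynomial.map_zero])
  obtain ⟨B', hB'⟩ := exists_eq_pow_of_derivative_eq_zero p (A := B.map (algebraMap F L))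
    (by rw [Polynomial.derivative_map, hAB.2, Polynomial.map_zero])
  rw [AbsolutelyIrreducible, sepPoly, hA', hB', Polynomial.map_pow, map_pow, ← sub_pow_char] at h
  exact not_irreducible_pow hprime.out.ne_one h

variable {K : Type*} [Field K] [Algebra F K]

/-- If `A(y) = B(x)`, `A'(y) ≠ 0` and `K = F(x, y)`, then `K / F(x)` is finite and separable. -/
theorem isSeparable_of_aeval_eq {x y : K} (hxy : adjoin F {x, y} = ⊤) {A B : F[X]}
    (h : Polynomial.aeval y A = Polynomial.aeval x B)
    (hA : Polynomial.aeval y (Polynomial.derivative A) ≠ 0) :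
    FiniteDimensional F⟮x⟯ K ∧ Algebra.IsSeparable F⟮x⟯ K := by
  let g : F⟮x⟯[X] := A.map (algebraMap F F⟮x⟯) -
    Polynomial.C (Polynomial.aeval (AdjoinSimple.gen F x) B)
  have hg : Polynomial.aeval y g = 0 := by
    have e : algebraMap F⟮x⟯ K (Polynomial.aeval (AdjoinSimple.gen F x) B) =
        Polynomial.aeval x B := by
      rw [← Polynomial.aeval_algebraMap_apply, AdjoinSimple.algebraMap_gen]
    rw [map_sub, Polynomial.aeval_map_algebraMap, Polynomial.aeval_C, e, h, sub_self]
  have hg' : Polynomial.aeval y (Polynomial.derivative g) ≠ 0 := by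
    simpa [g, Polynomial.derivative_map] using hA
  have hg0 : g ≠ 0 := by
    rintro h0
    simp [h0] at hg'
  have hint : IsIntegral F⟮x⟯ y := isAlgebraic_iff_isIntegral.1 ⟨g, hg0, hg⟩
  -- If the minimal polynomial had zero derivative, its multiple `g` would have a multiple root at
  -- `y`.
  have hsep : IsSeparable F⟮x⟯ y := by
    refine (Polynomial.separable_iff_derivative_ne_zero (minpoly.irreducible hint)).2 fun h0 => ?_
    obtain ⟨q, hq⟩ := minpoly.dvd F⟮x⟯ y hg
    rw [hq, Polynomial.derivative_mul, h0] at hg'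
    simp at hg'
  have htop : F⟮x⟯⟮y⟯ = ⊤ := by
    rw [← restrictScalars_eq_top_iff (K := F), adjoin_simple_adjoin_simple, hxy]
  have h1 : FiniteDimensional F⟮x⟯ F⟮x⟯⟮y⟯ := adjoin.finiteDimensional hint
  have h2 : Algebra.IsSeparable F⟮x⟯ F⟮x⟯⟮y⟯ :=
    (isSeparable_adjoin_simple_iff_isSeparable _ _).2 hsep
  rw [htop] at h1 h2
  exact ⟨Module.Finite.equiv (topEquiv (F := F⟮x⟯) (E := K)).toLinearEquiv,
    Algebra.IsSeparable.of_algHom F⟮x⟯ _ (topEquiv (F := F⟮x⟯) (E := K)).symm.toAlgHom⟩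

variable {A B : F[X]} [Algebra (CoordRing A B) K] [IsScalarTower F (CoordRing A B) K]

theorem algebraMap_mk_C (q : F[X]) :
    algebraMap (CoordRing A B) K (AdjoinRoot.mk (sepPoly A B) (Polynomial.C q)) =
      Polynomial.aeval (xFun K A B) q := by
  have : ((algebraMap (CoordRing A B) K).comp (AdjoinRoot.mk (sepPoly A B))).comp Polynomial.C =
      (Polynomial.aeval (R := F) (xFun K A B)).toRingHom := by
    refine Polynomial.ringHom_ext (fun c => ?_) ?_
    · simp only [RingHom.comp_apply, AlgHom.toRingHom_eq_coe, RingHom.coe_coe, Polynomial.aeval_C]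
      exact (IsScalarTower.algebraMap_apply F (CoordRing A B) K c).symm
    · simp [xFun]
  exact DFunLike.congr_fun this q

theorem algebraMap_mk_map_C (q : F[X]) :
    algebraMap (CoordRing A B) K (AdjoinRoot.mk (sepPoly A B) (q.map Polynomial.C)) =
      Polynomial.aeval (yFun K A B) q := by
  have : ((algebraMap (CoordRing A B) K).comp (AdjoinRoot.mk (sepPoly A B))).comp
      (Polynomial.mapRingHom Polynomial.C) =
      (Polynomial.aeval (R := F) (yFun K A B)).toRingHom := by
    refine Polynomial.ringHom_ext (fun c => ?_) ?_
    · simp only [RingHom.comp_apply, Polynomial.coe_mapRingHom, Polynomial.map_C,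
        AlgHom.toRingHom_eq_coe, RingHom.coe_coe, Polynomial.aeval_C]
      exact (IsScalarTower.algebraMap_apply F (CoordRing A B) K c).symm
    · simp [yFun]
  exact DFunLike.congr_fun this q

theorem aeval_yFun_eq_aeval_xFun :
    Polynomial.aeval (yFun K A B) A = Polynomial.aeval (xFun K A B) B := by
  rw [← algebraMap_mk_C, ← algebraMap_mk_map_C, ← sub_eq_zero, ← map_sub, ← map_sub]
  exact (congrArg _ AdjoinRoot.mk_self).trans (map_zero _)

theorem adjoin_xFun_yFun [IsFractionRing (CoordRing A B) K] :
    adjoin F {xFun K A B, yFun K A B} = ⊤ := by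
  set M := adjoin F {xFun K A B, yFun K A B} with hM
  have hx : xFun K A B ∈ M := subset_adjoin F _ (by simp)
  have hy : yFun K A B ∈ M := subset_adjoin F _ (by simp)
  have key : ∀ a : CoordRing A B, algebraMap _ K a ∈ M := by
    intro a
    obtain ⟨p, rfl⟩ := AdjoinRoot.mk_surjective a
    induction p using Polynomial.induction_on' with
    | add p q hp hq =>
      rw [map_add, map_add]
      exact add_mem hp hq
    | monomial n q =>
      rw [← Polynomial.C_mul_X_pow_eq_monomial, map_mul, map_mul, algebraMap_mk_C, map_pow, map_pow,
        AdjoinRoot.mk_X]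
      exact mul_mem (Algebra.adjoin_le (S := M.toSubalgebra)
        (Set.singleton_subset_iff.2 hx) (Polynomial.aeval_mem_adjoin_singleton F _)) (pow_mem hy n)
  refine (eq_top_iff).2 fun z _ => ?_
  obtain ⟨a, b, _, rfl⟩ := IsFractionRing.div_surjective (A := CoordRing A B) z
  exact div_mem (key a) (key b)

/-- One of the coordinate functions `t` is a separating element of `K / F`; its only pole is `Q`. -/
theorem exists_separating_element [Finite F] [IsFractionRing (CoordRing A B) K]
    (hAB : AbsolutelyIrreducible A B) {Q : Place F K} (hQ : ConditionStar K A B Q) :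
    ∃ t : K, FiniteDimensional F⟮t⟯ K ∧ Algebra.IsSeparable F⟮t⟯ K ∧
      ∀ P : Place F K, P.IsPole t ↔ P = Q := by
  -- A function with a pole at `Q` is transcendental over `F`; this is applied to the derivative of
  -- `A` at `y` or of `B` at `x`.
  have hne : ∀ {t : K}, 1 < Q.v t → ∀ {p : F[X]}, p ≠ 0 → Polynomial.aeval t p ≠ 0 := by
    intro t ht p hp h0
    have := Q.v_aeval ht hp
    rw [h0, map_zero] at this
    exact pow_ne_zero _ (zero_lt_one.trans ht).ne' this.symm
  obtain ⟨-, hx, hy⟩ := hQ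
  rcases hAB.derivative_ne_zero with h | h
  · obtain ⟨h1, h2⟩ := isSeparable_of_aeval_eq adjoin_xFun_yFun aeval_yFun_eq_aeval_xFun
      (hne ((hy Q).2 rfl) h)
    exact ⟨_, h1, h2, hx⟩
  · obtain ⟨h1, h2⟩ := isSeparable_of_aeval_eq ((Set.pair_comm _ _).symm ▸ adjoin_xFun_yFun)
      aeval_yFun_eq_aeval_xFun.symm (hne ((hx Q).2 rfl) h)
    exact ⟨_, h1, h2, hy⟩

end SeparatedVariables

/-! ### The affine model attached to a separating element -/

section SeparatingElement

open IntermediateField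

variable {F K : Type*} [Field F] [Field K] [Algebra F K]

/-- The places where `t` is regular are exactly those other than `Q`. -/
theorem isAffineModel_integralClosure {Q : Place F K} {t : K} [FiniteDimensional F⟮t⟯ K]
    [Algebra.IsSeparable F⟮t⟯ K] (ht : ∀ P : Place F K, P.IsPole t ↔ P = Q) :
    IsAffineModel Q (integralClosure (Algebra.adjoin F {t}) K) := by
  intro f
  have e : f ∈ (algebraMap (integralClosure (Algebra.adjoin F {t}) K) K).range ↔
      IsIntegral (Algebra.adjoin F {t}) f :=
    ⟨by rintro ⟨g, rfl⟩; exact g.2, fun h => ⟨⟨f, h⟩, rfl⟩⟩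
  rw [e, isIntegral_adjoin_iff]
  refine forall_congr' fun P => ?_
  rw [← not_lt, ne_eq, ← ht P]
  rfl

theorem finiteDimensional_riemannSpace_of_separating {Q : Place F K} (hQ : Q.IsRational) {t : K}
    [FiniteDimensional F⟮t⟯ K] [Algebra.IsSeparable F⟮t⟯ K]
    (ht : ∀ P : Place F K, P.IsPole t ↔ P = Q) (E : Divisor F K) :
    FiniteDimensional F (riemannSpace E) ∧ ∀ f ∈ riemannSpace E, f ≠ 0 → 0 ≤ E.deg := by
  have hR := isAffineModel_integralClosure ht
  have h1 := isDedekindDomain_integralClosure_adjoin (F := F) t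
  have h2 := isFractionRing_integralClosure_adjoin (F := F) t
  have hc : HasOnlyConstants F K := fun f hf h =>
    Q.eq_one_of_forall_le_one ((ht Q).2 rfl) hf h
  exact ⟨hR.finiteDimensional_riemannSpace hc hQ E, fun f hf hf0 => hR.deg_nonneg hc hQ hf0 hf⟩

end SeparatingElement

/-! ### Arithmetic of values at a place -/

section Values

variable {F K : Type*} [Field F] [Field K] [Algebra F K] {P : Place F K}

theorem Place.HasValue.le_one {f : K} {c : F} (h : P.HasValue f c) : P.v f ≤ 1 := by
  have e : f = (f - algebraMap F K c) + algebraMap F K c := by ring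
  rw [e]
  exact P.v.map_add_le (le_of_lt h) (P.v_algebraMap_le c)

theorem Place.hasValue_zero_iff {f : K} : P.HasValue f 0 ↔ P.v f < 1 := by
  simp [Place.HasValue]

theorem Place.hasValue_algebraMap (c : F) : P.HasValue (algebraMap F K c) c := by
  simp [Place.HasValue]

theorem Place.HasValue.add {f g : K} {c d : F} (hf : P.HasValue f c) (hg : P.HasValue g d) :
    P.HasValue (f + g) (c + d) := by
  have e : f + g - algebraMap F K (c + d) =
      (f - algebraMap F K c) + (g - algebraMap F K d) := by rw [map_add]; ring
  rw [Place.HasValue, e]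
  exact P.v.map_add_lt hf hg

theorem Place.HasValue.mul {f g : K} {c d : F} (hf : P.HasValue f c) (hg : P.HasValue g d) :
    P.HasValue (f * g) (c * d) := by
  have e : f * g - algebraMap F K (c * d) =
      f * (g - algebraMap F K d) + algebraMap F K d * (f - algebraMap F K c) := by
    rw [map_mul]; ring
  rw [Place.HasValue, e]
  refine P.v.map_add_lt ?_ ?_
  · rw [map_mul]
    exact (mul_le_of_le_one_left' hf.le_one).trans_lt hg
  · rw [map_mul]
    exact (mul_le_of_le_one_left' (P.v_algebraMap_le d)).trans_lt hf

theorem Place.HasValue.smul {f : K} {c : F} (a : F) (hf : P.HasValue f c) :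
    P.HasValue (a • f) (a * c) := by
  rw [Algebra.smul_def]
  exact (Place.hasValue_algebraMap a).mul hf

theorem Place.HasValue.sub {f g : K} {c d : F} (hf : P.HasValue f c) (hg : P.HasValue g d) :
    P.HasValue (f - g) (c - d) := by
  simpa [sub_eq_add_neg] using hf.add (hg.smul (-1))

theorem Place.HasValue.pow {f : K} {c : F} (hf : P.HasValue f c) (n : ℕ) :
    P.HasValue (f ^ n) (c ^ n) := by
  induction n with
  | zero => simpa using P.hasValue_algebraMap (1 : F)
  | succ n ih =>
    rw [pow_succ, pow_succ]
    exact ih.mul hf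

end Values

/-! ### Sums of rational points -/

section PointDivisors

variable {F K : Type*} [Field F] [Field K] [Algebra F K]

open Classical in
theorem sum_single_apply (T : Finset (Place F K)) (P : Place F K) :
    (∑ P ∈ T, Finsupp.single P 1 : Divisor F K) P = if P ∈ T then 1 else 0 := by
  simp [Finsupp.finsetSum_apply, Finsupp.single_apply]

theorem Divisor.deg_sub (E E' : Divisor F K) : (E - E').deg = E.deg - E'.deg := by
  rw [eq_sub_iff_add_eq, ← Divisor.deg_add, sub_add_cancel]

theorem Divisor.deg_sum_single (T : Finset (Place F K)) (hT : ∀ P ∈ T, P.IsRational) :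
    Divisor.deg (∑ P ∈ T, Finsupp.single P 1) = T.card := by
  classical
  induction T using Finset.induction_on with
  | empty => simp [Divisor.deg]
  | insert P T hP ih =>
    rw [Finset.sum_insert hP, Divisor.deg_add, Divisor.deg_single,
      show P.degree = 1 from hT P (by simp), ih fun P' hP' => hT P' (by simp [hP']),
      Finset.card_insert_of_notMem hP]
    push_cast
    ring

theorem mem_riemannSpace_single_sub {Q : Place F K} {m : ℤ} {T : Finset (Place F K)}
    (hT : Q ∉ T) {f : K} :
    f ∈ riemannSpace (Finsupp.single Q m - ∑ P ∈ T, Finsupp.single P 1) ↔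
      f ∈ riemannSpace (Finsupp.single Q m) ∧ ∀ P ∈ T, P.v f < 1 := by
  classical
  rw [mem_riemannSpace, mem_riemannSpace]
  simp only [Finsupp.sub_apply, sum_single_apply]
  constructor
  · intro h
    refine ⟨fun P => (h P).trans (WithZero.exp_le_exp.2 ?_), fun P hP => ?_⟩
    · split_ifs <;> omega
    · have hPQ : P ≠ Q := fun e => hT (e ▸ hP)
      have := h P
      rw [if_pos hP, Finsupp.single_eq_of_ne hPQ] at this
      exact lt_one_iff_le_exp_neg_one.2 (by simpa using this)
  · rintro ⟨h1, h2⟩ P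
    by_cases hP : P ∈ T
    · have hPQ : P ≠ Q := fun e => hT (e ▸ hP)
      rw [if_pos hP, Finsupp.single_eq_of_ne hPQ]
      simpa using lt_one_iff_le_exp_neg_one.1 (h2 P hP)
    · rw [if_neg hP, sub_zero]
      exact h1 P

end PointDivisors

/-! ### Minimum distance of subcodes -/

section Codes

variable {F : Type*} [Field F] {ι : Type*} [Fintype ι]

open Classical in
theorem exists_hammingDist_eq_minDist {C : Submodule F (ι → F)} (hC : C ≠ ⊥) :
    ∃ u ∈ C, ∃ v ∈ C, u ≠ v ∧ hammingDist u v = minDist C := by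
  obtain ⟨u, hu, hu0⟩ := Submodule.exists_mem_ne_zero_of_ne_bot hC
  exact Nat.sInf_mem (s := {d | ∃ u ∈ C, ∃ v ∈ C, u ≠ v ∧ hammingDist u v = d})
    ⟨_, u, hu, 0, C.zero_mem, hu0, rfl⟩

/-- The smaller code has to be nonzero because `minDist` is `0` on the zero code. -/
theorem minDist_anti {C C' : Submodule F (ι → F)} (h : C ≤ C') (hC : C ≠ ⊥) :
    minDist C' ≤ minDist C := by
  classical
  obtain ⟨u, hu, v, hv, huv, hd⟩ := exists_hammingDist_eq_minDist hC
  rw [← hd]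
  exact Nat.sInf_le ⟨u, h hu, v, h hv, huv, by congr!⟩

end Codes

/-! ### Dimension and distance of evaluation codes -/

section EvaluationCodes

variable {F K : Type*} [Field F] [Field K] [Algebra F K]

theorem evalCode_mono (pts : Finset (Place F K)) {W W' : Submodule F K} (h : W ≤ W') :
    evalCode pts W ≤ evalCode pts W' := fun _ ⟨f, hf, hv⟩ => ⟨f, h hf, hv⟩

/-- The evaluation map of a space of functions that have values at the points of `pts`. -/
noncomputable def evalMap (pts : Finset (Place F K)) (W : Submodule F K)
    (h : ∀ f ∈ W, ∀ P ∈ pts, ∃ c : F, P.HasValue f c) : W →ₗ[F] (pts → F) where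
  toFun f P := (h f f.2 P P.2).choose
  map_add' f g := by
    ext P
    exact (h _ (f + g).2 P P.2).choose_spec.unique
      ((h f f.2 P P.2).choose_spec.add (h g g.2 P P.2).choose_spec)
  map_smul' a f := by
    ext P
    exact (h _ (a • f).2 P P.2).choose_spec.unique ((h f f.2 P P.2).choose_spec.smul a)

theorem evalMap_hasValue {pts : Finset (Place F K)} {W : Submodule F K}
    (h : ∀ f ∈ W, ∀ P ∈ pts, ∃ c : F, P.HasValue f c) (f : W) (P : pts) :
    P.1.HasValue (f : K) (evalMap pts W h f P) := (h f f.2 P P.2).choose_spec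

theorem range_evalMap {pts : Finset (Place F K)} {W : Submodule F K}
    (h : ∀ f ∈ W, ∀ P ∈ pts, ∃ c : F, P.HasValue f c) :
    LinearMap.range (evalMap pts W h) = evalCode pts W := by
  ext c
  constructor
  · rintro ⟨f, rfl⟩
    exact ⟨f, f.2, evalMap_hasValue h f⟩
  · rintro ⟨f, hf, hc⟩
    exact ⟨⟨f, hf⟩, funext fun P => (evalMap_hasValue h ⟨f, hf⟩ P).unique (hc P)⟩

theorem mem_ker_evalMap {pts : Finset (Place F K)} {W : Submodule F K}
    (h : ∀ f ∈ W, ∀ P ∈ pts, ∃ c : F, P.HasValue f c) (f : W) :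
    f ∈ LinearMap.ker (evalMap pts W h) ↔ ∀ P ∈ pts, P.v (f : K) < 1 := by
  rw [LinearMap.mem_ker]
  constructor
  · intro h0 P hP
    have := evalMap_hasValue h f ⟨P, hP⟩
    rwa [h0, Pi.zero_apply, Place.hasValue_zero_iff] at this
  · intro h0
    ext P
    exact (evalMap_hasValue h f P).unique (Place.hasValue_zero_iff.2 (h0 P P.2))

variable {Q : Place F K} {m : ℤ} {pts : Finset (Place F K)}

theorem exists_hasValue_of_mem (hpts : ∀ P ∈ pts, P.IsRational ∧ P ≠ Q) {W : Submodule F K}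
    (hW : W ≤ riemannSpace (Finsupp.single Q m)) :
    ∀ f ∈ W, ∀ P ∈ pts, ∃ c : F, P.HasValue f c := fun _ hf P hP =>
  (hpts P hP).1.exists_hasValue ((mem_riemannSpace_single.1 (hW hf)).1 P (hpts P hP).2)

/-- The dimension of an evaluation code. -/
theorem finrank_evalCode_add (hpts : ∀ P ∈ pts, P.IsRational ∧ P ≠ Q) {W : Submodule F K}
    (hW : W ≤ riemannSpace (Finsupp.single Q m)) [FiniteDimensional F W] :
    Module.finrank F (evalCode pts W) + Module.finrank F
      ↥(W ⊓ riemannSpace (Finsupp.single Q m - ∑ P ∈ pts, Finsupp.single P 1)) =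
      Module.finrank F W := by
  have h := exists_hasValue_of_mem hpts hW
  have hker : LinearMap.ker (evalMap pts W h) = (W ⊓ riemannSpace
      (Finsupp.single Q m - ∑ P ∈ pts, Finsupp.single P 1)).comap W.subtype := by
    ext f
    rw [mem_ker_evalMap, Submodule.mem_comap, Submodule.subtype_apply, Submodule.mem_inf,
      mem_riemannSpace_single_sub fun hQ => (hpts Q hQ).2 rfl]
    exact ⟨fun h0 => ⟨f.2, hW f.2, h0⟩, fun h0 => h0.2.2⟩
  rw [← LinearMap.finrank_range_add_finrank_ker (evalMap pts W h), range_evalMap, hker,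
    (Submodule.comapSubtypeEquivOfLe inf_le_left).finrank_eq]

/-- The bound for the minimum distance of `C(pts, L(mQ))` by the gonality sequence. -/
theorem minDist_evalCode_ge (hQ : Q.IsRational) (hpts : ∀ P ∈ pts, P.IsRational ∧ P ≠ Q)
    (hfin : ∀ E : Divisor F K, FiniteDimensional F (riemannSpace E))
    (hbdd : ∀ t : ℕ, BddBelow {δ : ℤ | ∃ E : Divisor F K, t + 1 ≤ ell E ∧ E.deg = δ})
    (hC : evalCode pts (riemannSpace (Finsupp.single Q m)) ≠ ⊥) :
    (pts.card : ℤ) - m + gonality F K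
        (ell (Finsupp.single Q m - ∑ P ∈ pts, Finsupp.single P 1) + 1) ≤
      minDist (evalCode pts (riemannSpace (Finsupp.single Q m))) := by
  classical
  obtain ⟨u, ⟨f, hf, hfu⟩, v, ⟨g, hg, hgv⟩, huv, hd⟩ := exists_hammingDist_eq_minDist hC
  -- The points where two words at minimum distance agree.
  let T : Finset (Place F K) :=
    (Finset.univ.filter fun P : pts => u P = v P).map (Function.Embedding.subtype _)
  have hT : ∀ P ∈ T, P ∈ pts := by
    intro P hP
    obtain ⟨P', -, rfl⟩ := Finset.mem_map.1 hP
    exact P'.2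
  have hQT : Q ∉ T := fun h => (hpts Q (hT Q h)).2 rfl
  have hQp : Q ∉ pts := fun h => (hpts Q h).2 rfl
  have hcard : T.card + hammingDist u v = pts.card := by
    rw [Finset.card_map, hammingDist, Finset.card_filter_add_card_filter_not,
      Finset.card_univ, Fintype.card_coe]
  have hmem : f - g ∈ riemannSpace (Finsupp.single Q m - ∑ P ∈ T, Finsupp.single P 1) := by
    rw [mem_riemannSpace_single_sub hQT]
    refine ⟨sub_mem hf hg, fun P hP => ?_⟩
    obtain ⟨P', hP', rfl⟩ := Finset.mem_map.1 hP
    have := (hfu P').sub (hgv P')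
    rwa [(Finset.mem_filter.1 hP').2, sub_self, Place.hasValue_zero_iff] at this
  have hnot : f - g ∉ riemannSpace (Finsupp.single Q m - ∑ P ∈ pts, Finsupp.single P 1) := by
    rw [mem_riemannSpace_single_sub hQp]
    rintro ⟨-, h⟩
    refine huv (funext fun P => sub_eq_zero.1 ?_)
    exact ((hfu P).sub (hgv P)).unique (Place.hasValue_zero_iff.2 (h P P.2))
  -- Strictness is what raises the gonality index from `w` to `w + 1`.
  have hlt : riemannSpace (Finsupp.single Q m - ∑ P ∈ pts, Finsupp.single P 1) <
      riemannSpace (Finsupp.single Q m - ∑ P ∈ T, Finsupp.single P 1) := by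
    refine lt_of_le_of_ne (fun h hh => ?_) fun e => hnot (e ▸ hmem)
    rw [mem_riemannSpace_single_sub hQp] at hh
    exact (mem_riemannSpace_single_sub hQT).2 ⟨hh.1, fun P hP => hh.2 P (hT P hP)⟩
  have := hfin (Finsupp.single Q m - ∑ P ∈ T, Finsupp.single P 1)
  have hell := Submodule.finrank_lt_finrank_of_lt hlt
  have hgon : gonality F K
      (ell (Finsupp.single Q m - ∑ P ∈ pts, Finsupp.single P 1) + 1) ≤ m - T.card := by
    refine csInf_le (hbdd _) ⟨Finsupp.single Q m - ∑ P ∈ T, Finsupp.single P 1, hell, ?_⟩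
    rw [Divisor.deg_sub, Divisor.deg_single, Divisor.deg_sum_single T fun P hP =>
      (hpts P (hT P hP)).1, show Q.degree = 1 from hQ, Nat.cast_one, mul_one]
  rw [← hd]
  omega

end EvaluationCodes

/-! ### The space `V` and local recovery -/

section EvaluationSpace

variable {F K : Type*} [Field F] [Field K] [Algebra F K]

/-- Only an inequality, since `poleOrder` is truncated to `0` at zeros of `f`. -/
theorem Place.le_exp_poleOrder (P : Place F K) (f : K) :
    P.v f ≤ WithZero.exp (P.poleOrder f : ℤ) := by
  by_cases hf : f = 0
  · simp [hf]
  obtain ⟨n, hn⟩ := P.exists_eq_exp hf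
  rw [Place.poleOrder, hn, WithZero.log_exp, WithZero.exp_le_exp]
  exact n.self_le_toNat

theorem le_one_of_mem_riemannSpaceInfty {Q : Place F K} {f : K} (hf : f ∈ riemannSpaceInfty Q)
    {P : Place F K} (hP : P ≠ Q) : P.v f ≤ 1 := by
  obtain ⟨j, hj⟩ := Set.mem_iUnion.1 hf
  exact (mem_riemannSpace_single.1 hj).1 P hP

instance finiteDimensional_evalSpace (φ₁ φ₂ : K) {r : ℕ} (ε : Fin r → Fin 2) (l : Fin r → ℕ) :
    FiniteDimensional F (evalSpace F φ₁ φ₂ ε l) := by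
  have : ∀ i : Fin r, FiniteDimensional F (Submodule.span F
      {f | ∃ j ≤ l i, f = ((ε i : ℕ) : K) * (φ₁ ^ j * φ₂ ^ (i : ℕ))}) := by
    intro i
    refine FiniteDimensional.span_of_finite F (((Set.finite_Iic (l i)).image
      fun j => ((ε i : ℕ) : K) * (φ₁ ^ j * φ₂ ^ (i : ℕ))).subset ?_)
    rintro _ ⟨j, hj, rfl⟩
    exact ⟨j, hj, rfl⟩
  rw [evalSpace]
  infer_instance

theorem evalSpace_le_riemannSpace {Q : Place F K} {φ₁ φ₂ : K} (h₁ : φ₁ ∈ riemannSpaceInfty Q)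
    (h₂ : φ₂ ∈ riemannSpaceInfty Q) {r : ℕ} (ε : Fin r → Fin 2) (l : Fin r → ℕ) :
    evalSpace F φ₁ φ₂ ε l ≤
      riemannSpace (Finsupp.single Q (evalSpaceBound Q φ₁ φ₂ ε l : ℤ)) := by
  refine iSup_le fun i => Submodule.span_le.2 ?_
  rintro _ ⟨j, hj, rfl⟩
  rcases Fin.exists_fin_two.1 ⟨ε i, rfl⟩ with hε | hε
  · simp [hε]
  have hm : l i * Q.poleOrder φ₁ + (i : ℕ) * Q.poleOrder φ₂ ≤ evalSpaceBound Q φ₁ φ₂ ε l := by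
    have := Finset.le_sup (f := fun i : Fin r =>
      (ε i : ℕ) * (l i * Q.poleOrder φ₁ + (i : ℕ) * Q.poleOrder φ₂)) (Finset.mem_univ i)
    rw [hε, Fin.val_one, one_mul] at this
    exact this
  rw [hε]
  simp only [Fin.val_one, Nat.cast_one, one_mul]
  refine mem_riemannSpace_single.2 ⟨fun P hP => ?_, ?_⟩
  · rw [map_mul, map_pow, map_pow]
    exact mul_le_one' (pow_le_one' (le_one_of_mem_riemannSpaceInfty h₁ hP) _)
      (pow_le_one' (le_one_of_mem_riemannSpaceInfty h₂ hP) _)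
  · rw [map_mul, map_pow, map_pow]
    calc Q.v φ₁ ^ j * Q.v φ₂ ^ (i : ℕ)
        ≤ WithZero.exp (Q.poleOrder φ₁ : ℤ) ^ j * WithZero.exp (Q.poleOrder φ₂ : ℤ) ^ (i : ℕ) :=
          mul_le_mul' (pow_le_pow_left' (Q.le_exp_poleOrder φ₁) _)
            (pow_le_pow_left' (Q.le_exp_poleOrder φ₂) _)
      _ = WithZero.exp ((j * Q.poleOrder φ₁ + i * Q.poleOrder φ₂ : ℕ) : ℤ) := by
          rw [← WithZero.exp_nsmul, ← WithZero.exp_nsmul, ← WithZero.exp_add]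
          simp
      _ ≤ _ := by
          rw [WithZero.exp_le_exp, Nat.cast_le]
          exact le_trans (by gcongr) hm

/-- On a set where `φ₁` is constant, the functions of `V` are polynomials of degree less than `r`
in `φ₂`. -/
theorem exists_polynomial_of_mem_evalSpace {φ₁ φ₂ : K} {S : Finset (Place F K)}
    (hS : IsConstantOn φ₁ S) {r : ℕ} (ε : Fin r → Fin 2) (l : Fin r → ℕ) {f : K}
    (hf : f ∈ evalSpace F φ₁ φ₂ ε l) :
    ∃ g : F[X], g.degree < r ∧ ∀ P ∈ S, ∀ b, P.HasValue φ₂ b → P.HasValue f (g.eval b) := by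
  obtain ⟨c, hc⟩ := hS
  let M : Submodule F K :=
    { carrier := {f | ∃ g : F[X], g ∈ Polynomial.degreeLT F r ∧
        ∀ P ∈ S, ∀ b, P.HasValue φ₂ b → P.HasValue f (g.eval b)}
      add_mem' := by
        rintro f f' ⟨g, hg, h⟩ ⟨g', hg', h'⟩
        refine ⟨g + g', add_mem hg hg', fun P hP b hb => ?_⟩
        rw [Polynomial.eval_add]
        exact (h P hP b hb).add (h' P hP b hb)
      zero_mem' := ⟨0, zero_mem _, fun P _ b _ => by simp [Place.HasValue]⟩
      smul_mem' := by
        rintro a f ⟨g, hg, h⟩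
        refine ⟨a • g, Submodule.smul_mem _ a hg, fun P hP b hb => ?_⟩
        rw [Polynomial.eval_smul]
        exact (h P hP b hb).smul a }
  have hM : evalSpace F φ₁ φ₂ ε l ≤ M := by
    refine iSup_le fun i => Submodule.span_le.2 ?_
    rintro _ ⟨j, _, rfl⟩
    -- On `S` the power of `φ₁` becomes the constant `c ^ j`, leaving a monomial of degree `i < r`
    -- in `φ₂`.
    refine ⟨Polynomial.monomial i (((ε i : ℕ) : F) * c ^ j), Polynomial.mem_degreeLT.2 ?_,
      fun P hP b hb => ?_⟩
    · exact (Polynomial.degree_monomial_le _ _).trans_lt (by exact_mod_cast i.2)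
    · rw [Polynomial.eval_monomial, mul_assoc, ← map_natCast (algebraMap F K)]
      exact (Place.hasValue_algebraMap _).mul (((hc P hP).pow j).mul (hb.pow i))
  obtain ⟨g, hg, h⟩ := hM hf
  exact ⟨g, Polynomial.mem_degreeLT.1 hg, h⟩

theorem isLocallyRecoverableAt_evalCode [Finite F] {φ₁ φ₂ : K} {S pts : Finset (Place F K)}
    (hS : IsConstantOn φ₁ S) (hSpts : S ⊆ pts) {r : ℕ} (ε : Fin r → Fin 2) (l : Fin r → ℕ)
    (hval : ∀ P ∈ S, ∃ b : F, P.HasValue φ₂ b) (hr : r + 1 ≤ numValues φ₂ S)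
    (i : pts) (hi : i.1 ∈ S) :
    IsLocallyRecoverableAt (evalCode pts (evalSpace F φ₁ φ₂ ε l)) i r := by
  classical
  obtain ⟨b₀, hb₀⟩ := hval i hi
  -- Discarding the value at the erased point leaves `r` others; one point is chosen for each of `r`
  -- such values.
  have hcard : r ≤ ({c : F | ∃ P ∈ S, P.HasValue φ₂ c} \ {b₀}).ncard :=
    (Nat.le_sub_of_add_le hr).trans (Set.pred_ncard_le_ncard_sdiff_singleton _ _)
  obtain ⟨U', hU', hU'card⟩ := Set.exists_subset_card_eq hcard
  obtain ⟨U, rfl⟩ := (Set.toFinite U').exists_finset_coe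
  rw [Set.ncard_coe_finset] at hU'card
  have hU : ∀ b : U, ∃ P : pts, P.1 ∈ S ∧ P.1.HasValue φ₂ (b : F) := by
    intro b
    obtain ⟨⟨P, hP, hPb⟩, -⟩ := hU' b.2
    exact ⟨⟨P, hSpts hP⟩, hP, hPb⟩
  choose p hpS hpv using hU
  have hinj : Function.Injective p := fun b b' h =>
    Subtype.ext ((hpv b).unique (by rw [h]; exact hpv b'))
  refine ⟨Finset.univ.map ⟨p, hinj⟩, ?_, ?_, ?_⟩
  · intro h
    obtain ⟨b, -, rfl⟩ := Finset.mem_map.1 h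
    exact (hU' b.2).2 ((hpv b).unique hb₀)
  · rw [Finset.card_map, Finset.card_univ, Fintype.card_coe, hU'card]
  · rintro u ⟨f, hf, hfu⟩ v ⟨f', hf', hfv⟩ huv
    obtain ⟨g, hg, hgv⟩ := exists_polynomial_of_mem_evalSpace hS ε l (sub_mem hf hf')
    have hg0 : g = 0 := by
      -- The polynomial of the difference has degree less than `r` and vanishes at `r` values.
      refine Polynomial.eq_zero_of_degree_lt_of_eval_finset_eq_zero U (by rwa [hU'card]) ?_
      intro b hb
      have h1 := hgv _ (hpS ⟨b, hb⟩) _ (hpv ⟨b, hb⟩)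
      rw [h1.unique ((hfu _).sub (hfv _)), huv (p ⟨b, hb⟩) (Finset.mem_map.2 ⟨⟨b, hb⟩, by simp, rfl⟩),
        sub_self]
    have h2 := hgv _ hi _ hb₀
    rw [hg0, Polynomial.eval_zero] at h2
    exact sub_eq_zero.1 (((hfu i).sub (hfv i)).unique h2)

end EvaluationSpace

end SepCurve

/-! ### The main theorem -/

theorem mainTheorem1
    {F : Type*} [Field F] [Finite F]
    -- the curve `A(Y) = B(X)` and its function field `K`
    (A B : F[X]) (hAB : AbsolutelyIrreducible A B)
    {K : Type*} [Field K] [Algebra F K] [Algebra (CoordRing A B) K]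
    [IsScalarTower F (CoordRing A B) K] [IsFractionRing (CoordRing A B) K]
    (Q : Place F K) (hQ : ConditionStar K A B Q)
    -- two functions with poles at most at `Q`
    (φ₁ φ₂ : K) (hφ₁ : φ₁ ∈ riemannSpaceInfty Q) (hφ₂ : φ₂ ∈ riemannSpaceInfty Q)
    -- disjoint sets of rational points other than `Q`, on each of which `φ₁` is constant
    {s : ℕ} (S : Fin s → Finset (Place F K))
    (hrat : ∀ i, ∀ P ∈ S i, P.IsRational ∧ P ≠ Q)
    (hdisj : Pairwise fun i j => Disjoint (S i) (S j))
    (hconst : ∀ i, IsConstantOn φ₁ (S i))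
    -- the union `pts` of those sets on which `φ₂` takes at least `r + 1` values
    (r : ℕ) (hr : 1 ≤ r) (pts : Finset (Place F K))
    (hpts : ∀ P, P ∈ pts ↔ ∃ i, r + 1 ≤ numValues φ₂ (S i) ∧ P ∈ S i)
    (n : ℕ) (hn : n = pts.card)
    (D : Divisor F K) (hD : D = ∑ P ∈ pts, Finsupp.single P 1)
    -- the space `V`, the number `m = m(V)` and the divisor `G = mQ`
    (ε : Fin r → Fin 2) (l : Fin r → ℕ)
    (V : Submodule F K) (hV : V = evalSpace F φ₁ φ₂ ε l)
    (m : ℕ) (hm : m = evalSpaceBound Q φ₁ φ₂ ε l)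
    (G : Divisor F K) (hG : G = Finsupp.single Q (m : ℤ))
    (w : ℕ) (hw : w = ell (G - D))
    (k : ℕ) (hk : k = Module.finrank F (evalCode pts V)) :
    -- locality
    IsLRC (evalCode pts V) r ∧
    -- dimension
    (k : ℤ) = (Module.finrank F V : ℤ) - Module.finrank F ↥(V ⊓ riemannSpace (G - D)) ∧
    (k : ℤ) ≥ (Module.finrank F V : ℤ) - w ∧
    -- minimum distance
    (evalCode pts V ≠ ⊥ →
      minDist (evalCode pts V) ≥ minDist (evalCode pts (riemannSpace G)) ∧
      (minDist (evalCode pts V) : ℤ) ≥ (n : ℤ) - m + gonality F K (w + 1)) ∧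
    (evalCode pts (riemannSpace G) ≠ ⊥ →
      (minDist (evalCode pts (riemannSpace G)) : ℤ) ≥ (n : ℤ) - m + gonality F K (w + 1)) ∧
    -- the case `m < n`
    (m < n → w = 0 ∧ k = Module.finrank F V ∧
      (evalCode pts V ≠ ⊥ → (minDist (evalCode pts V) : ℤ) ≥ (n : ℤ) - m)) := by
  classical
  subst hn hD hV hm hG hw hk
  obtain ⟨t, _, _, ht⟩ := exists_separating_element hAB hQ
  have hQr : Q.IsRational := hQ.1
  have hfin := fun E => (finiteDimensional_riemannSpace_of_separating hQr ht E).1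
  have hdeg := fun E => (finiteDimensional_riemannSpace_of_separating hQr ht E).2
  have hdeg' : ∀ E : Divisor F K, 0 < ell E → 0 ≤ E.deg := by
    intro E hE
    obtain ⟨f, hf, hf0⟩ := Submodule.exists_mem_ne_zero_of_ne_bot
      (p := riemannSpace E) (by
        rintro h
        rw [ell, h, finrank_bot] at hE
        exact lt_irrefl 0 hE)
    exact hdeg E f hf hf0
  -- The index `t + 1` forces `L(E) ≠ 0`; boundedness below makes the integer infimum in `gonality`
  -- meaningful.
  have hbdd : ∀ t : ℕ, BddBelow {δ : ℤ | ∃ E : Divisor F K, t + 1 ≤ ell E ∧ E.deg = δ} :=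
    fun t => ⟨0, by
      rintro _ ⟨E, hE, rfl⟩
      exact hdeg' E (by omega)⟩
  have hrat' : ∀ P ∈ pts, P.IsRational ∧ P ≠ Q := by
    intro P hP
    obtain ⟨i, -, hi⟩ := (hpts P).1 hP
    exact hrat i P hi
  have hVL := evalSpace_le_riemannSpace hφ₁ hφ₂ ε l
  have hdim := finrank_evalCode_add hrat' hVL
  have hker : Module.finrank F ↥(evalSpace F φ₁ φ₂ ε l ⊓ riemannSpace
      (Finsupp.single Q (evalSpaceBound Q φ₁ φ₂ ε l : ℤ) - ∑ P ∈ pts, Finsupp.single P 1)) ≤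
      ell (Finsupp.single Q (evalSpaceBound Q φ₁ φ₂ ε l : ℤ) -
        ∑ P ∈ pts, Finsupp.single P 1) := by
    have := hfin (Finsupp.single Q (evalSpaceBound Q φ₁ φ₂ ε l : ℤ) -
      ∑ P ∈ pts, Finsupp.single P 1)
    exact Submodule.finrank_mono inf_le_right
  have hdist := minDist_evalCode_ge (m := (evalSpaceBound Q φ₁ φ₂ ε l : ℤ)) hQr hrat' hfin hbdd
  have hmono := evalCode_mono pts hVL
  have hbot : evalCode pts (evalSpace F φ₁ φ₂ ε l) ≠ ⊥ →
      evalCode pts (riemannSpace (Finsupp.single Q (evalSpaceBound Q φ₁ φ₂ ε l : ℤ))) ≠ ⊥ :=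
    fun h h' => h (le_bot_iff.1 (h' ▸ hmono))
  refine ⟨fun i => ?_, by omega, by omega, fun h => ?_, hdist, fun hmn => ?_⟩
  · obtain ⟨k, hk, hi⟩ := (hpts i).1 i.2
    refine ⟨r, le_rfl, isLocallyRecoverableAt_evalCode (hconst k)
      (fun P hP => (hpts P).2 ⟨k, hk, hP⟩) ε l (fun P hP => ?_) hk i hi⟩
    exact (hrat k P hP).1.exists_hasValue (le_one_of_mem_riemannSpaceInfty hφ₂ (hrat k P hP).2)
  · have h1 := minDist_anti hmono h
    have h2 := hdist (hbot h)
    exact ⟨h1, by omega⟩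
  · have hw : ell (Finsupp.single Q (evalSpaceBound Q φ₁ φ₂ ε l : ℤ) -
        ∑ P ∈ pts, Finsupp.single P 1) = 0 := by
      -- The divisor `mQ - D` has degree `m - n < 0`.
      by_contra h
      have := hdeg' _ (Nat.pos_of_ne_zero h)
      rw [Divisor.deg_sub, Divisor.deg_single, Divisor.deg_sum_single _ fun P hP =>
        (hrat' P hP).1, show Q.degree = 1 from hQr] at this
      omega
    refine ⟨hw, by omega, fun h => ?_⟩
    have h1 := minDist_anti hmono h
    have h2 := hdist (hbot h)
    have h3 : 0 ≤ gonality F K (ell (Finsupp.single Q (evalSpaceBound Q φ₁ φ₂ ε l : ℤ) -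
        ∑ P ∈ pts, Finsupp.single P 1) + 1) := by
      rw [hw]
      have := hfin 0
      have h1 : (1 : K) ∈ riemannSpace (0 : Divisor F K) := fun P => by simp
      -- The zero divisor shows that the set of degrees is nonempty, since `1 ∈ L(0)`.
      refine le_csInf ⟨_, 0, ?_, rfl⟩ ?_
      · exact Nat.one_le_iff_ne_zero.2 fun h0 =>
          one_ne_zero ((Submodule.eq_bot_iff _).1 (Submodule.finrank_eq_zero.1 h0) 1 h1)
      · rintro _ ⟨E, hE, rfl⟩
        exact hdeg' E (by omega)
    omega
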